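/- Let $G$ be a compact group with normalized Haar measure $\mathrm{d}g$, and let $\{U_g\}_{g\in G}$ and $\{V_g\}_{g\in G}$ be continuous unitary representations of $G$ on $\mathcal H_{\rm in}=\mathbb C^{d_{\rm in}}$ and $\mathcal H_{\rm out}=\mathbb C^{d_{\rm out}}$, with $d_{\rm in},d_{\rm out}\ge 1$. For a unitary $W$ on $\mathbb C^d$ put $|\Phi_W\rangle=(W\otimes I)|\Phi\rangle$ with $|\Phi\rangle=d^{-1/2}\sum_{n=1}^d|n\rangle\otimes|n\rangle$, and write $|\Phi_{\rm out}\rangle$ for $|\Phi\rangle$ in the case $d=d_{\rm out}$. Let $F^{\rm det}_{\rm gate}[U_g\to V_g]$ be the optimal deterministic entanglement fidelity of simulating $V_g$ with one use of $U_g$, that is, the supremum of $$\int \mathrm{d}g\,\langle\Phi_{V_g}|\,(\mathcal C_g\otimes\mathcal I)\big(|\Phi_{\rm out}\rangle\langle\Phi_{\rm out}|\big)\,|\Phi_{V_g}\rangle ,\qquad \mathcal C_g(X)=\mathcal B\big((U_g\otimes I_{\mathcal M})\,\mathcal A(X)\,(U_g\otimes I_{\mathcal M})^\dagger\big),$$ over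 all finite-dimensional memory spaces $\mathcal M$ and all quantum channels (completely positive trace-preserving maps) $\mathcal A$ from operators on $\mathcal H_{\rm out}$ to operators on $\mathcal H_{\rm in}\otimes\mathcal M$ and $\mathcal B$ from operators on $\mathcal H_{\rm in}\otimes\mathcal M$ to operators on $\mathcal H_{\rm out}$. Let $F^{\rm prob}_{\rm Bell}[|\Phi_{U_g}\rangle\to|\Phi_{V_g}\rangle]$ be the optimal probabilistic fidelity of converting $|\Phi_{U_g}\rangle$ into $|\Phi_{V_g}\rangle$, that is, the supremum of $$\frac{\int \mathrm{d}g\,\langle\Phi_{V_g}|\,\mathcal Q\big(|\Phi_{U_g}\rangle\langle\Phi_{U_g}|\big)\,|\Phi_{V_g}\rangle}{\int \mathrm{d}g\,\mathrm{Tr}\big[\mathcal Q\big(|\Phi_{U_g}\rangle\langle\Phi_{U_g}|\big)\big]}$$ over all completely positive trace-non-increasing maps $\mathcal Q$ from operators on $\mathcal H_{\rm in}\otimes\mathcal H_{\rm in}$ to operators on $\mathcal H_{\rm out}\otimes\mathcal H_{\rm out}$ for which the denominator is nonzero. Both suprema are taken over nonempty sets of real numbers that are bounded above, and $$\big(F^{\rm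 prob}_{\rm Bell}[|\Phi_{U_g}\rangle\to|\Phi_{V_g}\rangle]\big)^2\;\le\;F^{\rm det}_{\rm gate}[U_g\to V_g]\;\le\;F^{\rm prob}_{\rm Bell}[|\Phi_{U_g}\rangle\to|\Phi_{V_g}\rangle].$$ -/

import Mathlib

open MeasureTheory
open scoped Matrix Kronecker ComplexOrder

noncomputable section

namespace BellConversion

/-- The extension `Φ ⊗ id` of a linear map `Φ` on matrices to a composite system, where `Φ` acts
on the first factor and the identity map acts on the second factor (with basis `ρ`). -/
def tensorId {α β : Type*} (Φ : Matrix α α ℂ →ₗ[ℂ] Matrix β β ℂ) (ρ : Type*)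
    (X : Matrix (α × ρ) (α × ρ) ℂ) : Matrix (β × ρ) (β × ρ) ℂ :=
  Matrix.of fun p q => Φ (Matrix.of fun i j => X (i, p.2) (j, q.2)) p.1 q.1

/-- Complete positivity: `Φ ⊗ id` preserves positive semidefiniteness for every finite-dimensional
ancilla. -/
def IsCompletelyPositive {α β : Type*} (Φ : Matrix α α ℂ →ₗ[ℂ] Matrix β β ℂ) : Prop :=
  ∀ (k : ℕ) (X : Matrix (α × Fin k) (α × Fin k) ℂ),
    X.PosSemidef → (tensorId Φ (Fin k) X).PosSemidef

/-- A quantum channel: a completely positive trace-preserving linear map. -/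
structure IsChannel {α β : Type*} [Fintype α] [Fintype β]
    (Φ : Matrix α α ℂ →ₗ[ℂ] Matrix β β ℂ) : Prop where
  completelyPositive : IsCompletelyPositive Φ
  trace_eq : ∀ X : Matrix α α ℂ, (Φ X).trace = X.trace

/-- A quantum operation: a completely positive trace-non-increasing linear map. -/
structure IsOperation {α β : Type*} [Fintype α] [Fintype β]
    (Φ : Matrix α α ℂ →ₗ[ℂ] Matrix β β ℂ) : Prop where
  completelyPositive : IsCompletelyPositive Φ
  trace_le : ∀ X : Matrix α α ℂ, X.PosSemidef → (Φ X).trace.re ≤ X.trace.re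

/-- The map `X ↦ W X W†`. -/
def conjMap {α : Type*} [Fintype α] (W : Matrix α α ℂ) : Matrix α α ℂ →ₗ[ℂ] Matrix α α ℂ where
  toFun X := W * X * Wᴴ
  map_add' X Y := by rw [Matrix.mul_add, Matrix.add_mul]
  map_smul' c X := by simp

/-- The canonical Bell state `|Φ⟩ = d^(-1/2) ∑ₙ |n⟩ ⊗ |n⟩`. -/
def bell (α : Type*) [Fintype α] [DecidableEq α] : α × α → ℂ :=
  fun p => if p.1 = p.2 then ((1 / Real.sqrt (Fintype.card α) : ℝ) : ℂ) else 0

/-- The Bell state `|Φ_W⟩ = (W ⊗ I) |Φ⟩`. -/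
def bellOf {α : Type*} [Fintype α] [DecidableEq α] (W : Matrix α α ℂ) : α × α → ℂ :=
  (W ⊗ₖ (1 : Matrix α α ℂ)) *ᵥ bell α

/-- The rank-one operator `|ψ⟩⟨ψ|`. -/
def ketbra {α : Type*} (ψ : α → ℂ) : Matrix α α ℂ := Matrix.vecMulVec ψ (star ψ)

/-- The overlap `⟨ψ| σ |ψ⟩` (a real number when `σ` is Hermitian). -/
def overlap {α : Type*} [Fintype α] (ψ : α → ℂ) (σ : Matrix α α ℂ) : ℝ :=
  (star ψ ⬝ᵥ (σ *ᵥ ψ)).re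

/-- The map implemented by a network with one open slot, when the gate `W` is inserted: first `A`,
then `W` on the slot system with the identity on the memory system, then `B`. -/
def network {α β ρ : Type*} [Fintype α] [Fintype ρ] [DecidableEq ρ]
    (A : Matrix β β ℂ →ₗ[ℂ] Matrix (α × ρ) (α × ρ) ℂ)
    (B : Matrix (α × ρ) (α × ρ) ℂ →ₗ[ℂ] Matrix β β ℂ)
    (W : Matrix α α ℂ) : Matrix β β ℂ →ₗ[ℂ] Matrix β β ℂ :=
  B ∘ₗ conjMap (W ⊗ₖ (1 : Matrix ρ ρ ℂ)) ∘ₗ A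

section Fidelities

variable {G : Type*} [Group G] [MeasurableSpace G]
  {α β : Type*} [Fintype α] [DecidableEq α] [Fintype β] [DecidableEq β]

/-- The entanglement fidelity, averaged over `G`, with which the network `(A, B)` simulates one use
of `V g` by means of one use of `U g`. -/
def gateFidelity (μ : Measure G) (U : G →* Matrix.unitaryGroup α ℂ)
    (V : G →* Matrix.unitaryGroup β ℂ) {ρ : Type*} [Fintype ρ] [DecidableEq ρ]
    (A : Matrix β β ℂ →ₗ[ℂ] Matrix (α × ρ) (α × ρ) ℂ)
    (B : Matrix (α × ρ) (α × ρ) ℂ →ₗ[ℂ] Matrix β β ℂ) : ℝ :=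
  ∫ g, overlap (bellOf (V g : Matrix β β ℂ))
    (tensorId (network A B (U g : Matrix α α ℂ)) β (ketbra (bell β))) ∂μ

/-- The fidelities of all deterministic simulations of `V g` with one use of `U g`: the devices `A`
and `B` are arbitrary channels and the memory has an arbitrary finite dimension. -/
def gateDetFidelities (μ : Measure G) (U : G →* Matrix.unitaryGroup α ℂ)
    (V : G →* Matrix.unitaryGroup β ℂ) : Set ℝ :=
  {F | ∃ (k : ℕ) (A : Matrix β β ℂ →ₗ[ℂ] Matrix (α × Fin k) (α × Fin k) ℂ)
      (B : Matrix (α × Fin k) (α × Fin k) ℂ →ₗ[ℂ] Matrix β β ℂ),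
      IsChannel A ∧ IsChannel B ∧ F = gateFidelity μ U V A B}

/-- The optimal deterministic entanglement fidelity of the gate simulation `U g → V g`. -/
def gateDet (μ : Measure G) (U : G →* Matrix.unitaryGroup α ℂ)
    (V : G →* Matrix.unitaryGroup β ℂ) : ℝ :=
  sSup (gateDetFidelities μ U V)

/-- The total success probability of the quantum operation `M` on the states `|Φ_{U g}⟩`. -/
def bellSuccess (μ : Measure G) (U : G →* Matrix.unitaryGroup α ℂ)
    (M : Matrix (α × α) (α × α) ℂ →ₗ[ℂ] Matrix (β × β) (β × β) ℂ) : ℝ :=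
  ∫ g, (M (ketbra (bellOf (U g : Matrix α α ℂ)))).trace.re ∂μ

/-- The average fidelity, conditioned on success, with which the quantum operation `M` converts
`|Φ_{U g}⟩` into `|Φ_{V g}⟩`. -/
def bellFidelity (μ : Measure G) (U : G →* Matrix.unitaryGroup α ℂ)
    (V : G →* Matrix.unitaryGroup β ℂ)
    (M : Matrix (α × α) (α × α) ℂ →ₗ[ℂ] Matrix (β × β) (β × β) ℂ) : ℝ :=
  (∫ g, overlap (bellOf (V g : Matrix β β ℂ)) (M (ketbra (bellOf (U g : Matrix α α ℂ)))) ∂μ) /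
    bellSuccess μ U M

/-- The fidelities of all probabilistic conversions of `|Φ_{U g}⟩` into `|Φ_{V g}⟩` that succeed
with nonzero probability. -/
def bellProbFidelities (μ : Measure G) (U : G →* Matrix.unitaryGroup α ℂ)
    (V : G →* Matrix.unitaryGroup β ℂ) : Set ℝ :=
  {F | ∃ M : Matrix (α × α) (α × α) ℂ →ₗ[ℂ] Matrix (β × β) (β × β) ℂ,
      IsOperation M ∧ 0 < bellSuccess μ U M ∧ F = bellFidelity μ U V M}

/-- The optimal fidelity of the probabilistic conversion `|Φ_{U g}⟩ → |Φ_{V g}⟩`. -/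
def bellProb (μ : Measure G) (U : G →* Matrix.unitaryGroup α ℂ)
    (V : G →* Matrix.unitaryGroup β ℂ) : ℝ :=
  sSup (bellProbFidelities μ U V)

end Fidelities

end BellConversion

end

set_option linter.unusedSectionVars false

/-! Write `|W⟩⟩` for the vector of entries of `W`, so that `|Φ_W⟩ = d^(-1/2) |W⟩⟩`, and let `F` be
the gate optimum.

Upper bound: a network with Kraus operators `B_l (U_g ⊗ 1) A_i` is linear in `U_g`, so there are
matrices `K` with `K |U_g⟩⟩ = |B_l (U_g ⊗ 1) A_i⟩⟩`. Scaled down to an operation, they convert Bell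
states with the fidelity of the network, because trace preservation makes the success probability
independent of `g`. Hence `gateDetFidelities_subset`, and both sets are bounded by 1.

Lower bound: by Choi's theorem it suffices to bound the contribution of each Kraus operator `K`. Put
`f(g) = conj ⟨⟨V_g|K|U_g⟩⟩` and `N = ∫ |f|²`. The decoder is a pretty good measurement followed by
`V_g`: `D_g = ⟨⟨U_g| q ⊗ V_g`, where `q` is the inverse square root of `ε + ∫ |U_g⟩⟩⟨⟨U_g|`. The
encoder is `N^(-1/2) L` with `L = ∫ f(g) D_g†`. Covariance of `D` and Cauchy–Schwarz over `G` give
`(‖L‖² / (N d_out))² ≤ F` (`frobSq_matInt_div_sq_le_gateDet`). On the other hand `N` is a pairing of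
`K q⁻¹` with `L`, so `N² ≤ ‖K q⁻¹‖² ‖L‖²`, and `‖K q⁻¹‖²` is the average weight of `K |U_g⟩⟩` up to
`ε ‖K‖²`. Eliminating `‖L‖²` and letting `ε → 0` bounds `N` by `d_out √F` times that weight; summing
over Kraus operators gives `F_Bell ≤ √F`. -/

namespace BellConversion

/-! ### Frobenius norm and Cauchy–Schwarz for matrices. -/

section Frobenius

variable {m n k : Type*} [Fintype m] [Fintype n] [Fintype k]

/-- The squared Frobenius norm of a complex matrix. -/
noncomputable def frobSq (M : Matrix m n ℂ) : ℝ := ∑ i, ∑ j, ‖M i j‖ ^ 2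

lemma frobSq_nonneg (M : Matrix m n ℂ) : 0 ≤ frobSq M := by
  unfold frobSq; positivity

lemma trace_mul_conjTranspose (M : Matrix m n ℂ) : (M * Mᴴ).trace = (frobSq M : ℂ) := by
  simp only [Matrix.trace, Matrix.diag_apply, Matrix.mul_apply, Matrix.conjTranspose_apply, frobSq]
  push_cast
  refine Finset.sum_congr rfl fun i _ => Finset.sum_congr rfl fun j _ => ?_
  rw [Complex.star_def, Complex.mul_conj']

lemma frobSq_conjTranspose (M : Matrix m n ℂ) : frobSq Mᴴ = frobSq M := by
  unfold frobSq
  rw [Finset.sum_comm]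
  simp [Matrix.conjTranspose_apply]

lemma trace_conjTranspose_mul (M : Matrix m n ℂ) : (Mᴴ * M).trace = (frobSq M : ℂ) := by
  rw [← frobSq_conjTranspose, ← trace_mul_conjTranspose, Matrix.conjTranspose_conjTranspose]

lemma norm_sum_mul_sq_le {ι : Type*} (s : Finset ι) (a b : ι → ℂ) :
    ‖∑ i ∈ s, a i * b i‖ ^ 2 ≤ (∑ i ∈ s, ‖a i‖ ^ 2) * ∑ i ∈ s, ‖b i‖ ^ 2 := by
  refine le_trans ?_ (Finset.sum_mul_sq_le_sq_mul_sq s (fun i => ‖a i‖) (fun i => ‖b i‖))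
  gcongr
  refine (norm_sum_le _ _).trans (le_of_eq ?_)
  simp

lemma frobSq_mul_le (M : Matrix m n ℂ) (N : Matrix n k ℂ) :
    frobSq (M * N) ≤ frobSq M * frobSq N := by
  have h : ∀ i j, ‖(M * N) i j‖ ^ 2 ≤ (∑ l, ‖M i l‖ ^ 2) * ∑ l, ‖N l j‖ ^ 2 := fun i j =>
    norm_sum_mul_sq_le Finset.univ (fun l => M i l) (fun l => N l j)
  calc frobSq (M * N) ≤ ∑ i, ∑ j, (∑ l, ‖M i l‖ ^ 2) * ∑ l, ‖N l j‖ ^ 2 :=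
        Finset.sum_le_sum fun i _ => Finset.sum_le_sum fun j _ => h i j
    _ = frobSq M * frobSq N := by
        simp only [← Finset.mul_sum, ← Finset.sum_mul, frobSq]
        congr 1
        exact Finset.sum_comm

lemma PosSemidef.exists_conjTranspose_mul_self {M : Matrix n n ℂ} (hM : M.PosSemidef) :
    ∃ B : Matrix n n ℂ, M = Bᴴ * B := by
  classical
  open scoped MatrixOrder in
  obtain ⟨B, hB⟩ := CStarAlgebra.nonneg_iff_eq_star_mul_self.mp hM.nonneg
  exact ⟨B, hB⟩

end Frobenius

/-! ### Completely positive maps and Kraus decompositions. -/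

section Kraus

variable {α β γ ρ : Type*} [Fintype α] [Fintype β] [Fintype γ] [Fintype ρ]

/-- The map `X ↦ K X K†` for a rectangular matrix `K`. -/
def rectConj (K : Matrix β α ℂ) : Matrix α α ℂ →ₗ[ℂ] Matrix β β ℂ where
  toFun X := K * X * Kᴴ
  map_add' X Y := by rw [Matrix.mul_add, Matrix.add_mul]
  map_smul' c X := by simp

lemma rectConj_apply (K : Matrix β α ℂ) (X : Matrix α α ℂ) : rectConj K X = K * X * Kᴴ := rfl

lemma tensorId_rectConj [DecidableEq ρ] (K : Matrix β α ℂ) (X : Matrix (α × ρ) (α × ρ) ℂ) :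
    tensorId (rectConj K) ρ X = (K ⊗ₖ (1 : Matrix ρ ρ ℂ)) * X * (K ⊗ₖ (1 : Matrix ρ ρ ℂ))ᴴ := by
  ext ⟨b, r⟩ ⟨b', r'⟩
  simp [tensorId, rectConj_apply, Matrix.mul_apply, Fintype.sum_prod_type, Matrix.one_apply,
    Matrix.conjTranspose_apply, Matrix.kroneckerMap_apply, apply_ite (starRingEnd ℂ)]

lemma isCompletelyPositive_rectConj (K : Matrix β α ℂ) : IsCompletelyPositive (rectConj K) := by
  intro k X hX
  rw [tensorId_rectConj]
  exact hX.mul_mul_conjTranspose_same _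

lemma tensorId_add (Φ Ψ : Matrix α α ℂ →ₗ[ℂ] Matrix β β ℂ) (X : Matrix (α × ρ) (α × ρ) ℂ) :
    tensorId (Φ + Ψ) ρ X = tensorId Φ ρ X + tensorId Ψ ρ X := rfl

lemma tensorId_sum {ι : Type*} (s : Finset ι) (Φ : ι → Matrix α α ℂ →ₗ[ℂ] Matrix β β ℂ)
    (X : Matrix (α × ρ) (α × ρ) ℂ) :
    tensorId (∑ i ∈ s, Φ i) ρ X = ∑ i ∈ s, tensorId (Φ i) ρ X := by
  ext p q
  simp [tensorId, Matrix.sum_apply, LinearMap.sum_apply]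

lemma IsCompletelyPositive.add {Φ Ψ : Matrix α α ℂ →ₗ[ℂ] Matrix β β ℂ}
    (hΦ : IsCompletelyPositive Φ) (hΨ : IsCompletelyPositive Ψ) : IsCompletelyPositive (Φ + Ψ) :=
  fun k X hX => (hΦ k X hX).add (hΨ k X hX)

lemma IsCompletelyPositive.comp {Ψ : Matrix β β ℂ →ₗ[ℂ] Matrix γ γ ℂ}
    {Φ : Matrix α α ℂ →ₗ[ℂ] Matrix β β ℂ}
    (hΨ : IsCompletelyPositive Ψ) (hΦ : IsCompletelyPositive Φ) : IsCompletelyPositive (Ψ ∘ₗ Φ) :=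
  fun k X hX => hΨ k _ (hΦ k X hX)

lemma isCompletelyPositive_sum {ι : Type*} (s : Finset ι)
    (Φ : ι → Matrix α α ℂ →ₗ[ℂ] Matrix β β ℂ) (h : ∀ i ∈ s, IsCompletelyPositive (Φ i)) :
    IsCompletelyPositive (∑ i ∈ s, Φ i) := by
  intro k X hX
  rw [tensorId_sum]
  exact Matrix.posSemidef_sum _ fun i hi => h i hi k X hX

/-- Choi's theorem: a completely positive map has a finite Kraus decomposition. -/
lemma IsCompletelyPositive.exists_kraus [DecidableEq α] {Φ : Matrix α α ℂ →ₗ[ℂ] Matrix β β ℂ}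
    (hΦ : IsCompletelyPositive Φ) :
    ∃ (m : ℕ) (K : Fin m → Matrix β α ℂ), Φ = ∑ n, rectConj (K n) := by
  let e := Fintype.equivFin α
  -- The unnormalised Bell vector, with its second leg indexed by `Fin` because complete positivity
  -- is tested on such ancillas. Its image is the Choi matrix.
  let ω : α × Fin (Fintype.card α) → ℂ := fun p => if e p.1 = p.2 then 1 else 0
  have hpos := hΦ _ (Matrix.vecMulVec ω (star ω)) (Matrix.posSemidef_vecMulVec_self_star ω)
  obtain ⟨B, hB⟩ := PosSemidef.exists_conjTranspose_mul_self hpos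
  have hchoi : ∀ (a a' : α) (b b' : β),
      Φ (Matrix.single a a' 1) b b' = ∑ n, star (B n (b, e a)) * B n (b', e a') := by
    intro a a' b b'
    have h := congrFun (congrFun hB (b, e a)) (b', e a')
    rw [Matrix.mul_apply] at h
    simp only [Matrix.conjTranspose_apply] at h
    rw [← h]
    simp only [tensorId, Matrix.of_apply]
    refine congrFun (congrFun (congrArg Φ ?_) b) b'
    ext i j
    simp [ω, Matrix.single_apply, Matrix.vecMulVec_apply, eq_comm, ite_and]
    split_ifs <;> rfl
  let f := Fintype.equivFin (β × Fin (Fintype.card α))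
  -- With the Choi matrix equal to `Bᴴ * B`, each row of `B`, conjugated and reshaped, is a Kraus
  -- operator.
  refine ⟨_, fun n => Matrix.of fun b a => star (B (f.symm n) (b, e a)), ?_⟩
  refine Matrix.ext_linearMap ℂ fun a a' => LinearMap.ext_ring ?_
  ext x y
  simp only [LinearMap.comp_apply, LinearMap.sum_apply, Matrix.sum_apply]
  rw [show (Matrix.singleLinearMap ℂ a a') (1 : ℂ) = Matrix.single a a' 1 from rfl, hchoi,
    ← Equiv.sum_comp f.symm]
  refine Finset.sum_congr rfl fun n _ => ?_
  simp [rectConj_apply, Matrix.mul_apply, Matrix.single_apply, ite_and]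

end Kraus

lemma integrable_of_continuous {G E : Type*} [TopologicalSpace G] [CompactSpace G]
    [MeasurableSpace G] [BorelSpace G] (μ : Measure G) [IsProbabilityMeasure μ]
    [NormedAddCommGroup E] {f : G → E} (hf : Continuous f) : Integrable f μ :=
  hf.integrable_of_hasCompactSupport (HasCompactSupport.of_compactSpace f)

/-! ### Fidelities in terms of Kraus operators. -/

section Overlap

variable {α β : Type*} [Fintype α] [Fintype β]

/-- The vector of entries of a matrix. -/
def rowVec (W : Matrix β α ℂ) : β × α → ℂ := fun p => W p.1 p.2

lemma bellOf_eq [DecidableEq α] (W : Matrix α α ℂ) :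
    bellOf W = ((1 / Real.sqrt (Fintype.card α) : ℝ) : ℂ) • rowVec W := by
  ext ⟨i, j⟩
  simp [bellOf, bell, rowVec, Matrix.mulVec, dotProduct, Fintype.sum_prod_type, Matrix.one_apply,
    mul_comm]

lemma overlap_add (ψ : α → ℂ) (σ τ : Matrix α α ℂ) :
    overlap ψ (σ + τ) = overlap ψ σ + overlap ψ τ := by
  simp [overlap, Matrix.add_mulVec, dotProduct_add]

lemma overlap_sum {ι : Type*} (s : Finset ι) (ψ : α → ℂ) (σ : ι → Matrix α α ℂ) :
    overlap ψ (∑ i ∈ s, σ i) = ∑ i ∈ s, overlap ψ (σ i) := by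
  simp [overlap, Matrix.sum_mulVec, dotProduct_sum]

lemma overlap_ketbra (ψ φ : α → ℂ) : overlap ψ (ketbra φ) = ‖star ψ ⬝ᵥ φ‖ ^ 2 := by
  have h : star ψ ⬝ᵥ (ketbra φ *ᵥ ψ) = (star ψ ⬝ᵥ φ) * star (star ψ ⬝ᵥ φ) := by
    rw [ketbra, Matrix.vecMulVec_mulVec, dotProduct_smul, Matrix.star_dotProduct]
    simp
  rw [overlap, h, Complex.star_def, Complex.mul_conj']
  norm_cast

lemma rectConj_ketbra (K : Matrix β α ℂ) (φ : α → ℂ) : rectConj K (ketbra φ) = ketbra (K *ᵥ φ) := by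
  rw [rectConj_apply, ketbra, ketbra, Matrix.mul_vecMulVec, Matrix.vecMulVec_mul,
    Matrix.star_mulVec]

lemma trace_ketbra (φ : α → ℂ) : (ketbra φ).trace.re = ∑ i, ‖φ i‖ ^ 2 := by
  simp only [Matrix.trace, Matrix.diag_apply, ketbra, Matrix.vecMulVec_apply, Pi.star_apply,
    Complex.re_sum, Complex.star_def, Complex.mul_conj']
  norm_cast

lemma sum_norm_smul_sq (c : ℂ) (φ : α → ℂ) : ∑ i, ‖(c • φ) i‖ ^ 2 = ‖c‖ ^ 2 * ∑ i, ‖φ i‖ ^ 2 := by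
  simp [mul_pow, Finset.mul_sum]

lemma sum_norm_rowVec_sq (W : Matrix β α ℂ) : ∑ p, ‖rowVec W p‖ ^ 2 = frobSq W := by
  simp [rowVec, frobSq, Fintype.sum_prod_type]

lemma star_rowVec_dotProduct (W N : Matrix β α ℂ) :
    star (rowVec W) ⬝ᵥ rowVec N = (Wᴴ * N).trace := by
  simp only [dotProduct, rowVec, Fintype.sum_prod_type, Matrix.trace, Matrix.diag_apply,
    Matrix.mul_apply, Matrix.conjTranspose_apply, Pi.star_apply]
  exact Finset.sum_comm

lemma norm_sqrt_card_inv_sq (α : Type*) [Fintype α] :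
    ‖((1 / Real.sqrt (Fintype.card α) : ℝ) : ℂ)‖ ^ 2 = 1 / Fintype.card α := by
  rw [Complex.norm_real, Real.norm_eq_abs, sq_abs, div_pow, Real.sq_sqrt (by positivity), one_pow]

lemma tensorId_rectConj_ketbra_bell [DecidableEq β] (N : Matrix β β ℂ) :
    tensorId (rectConj N) β (ketbra (bell β)) = ketbra (bellOf N) := by
  rw [tensorId_rectConj, ← rectConj_apply, rectConj_ketbra, bellOf]

/-- The entanglement fidelity of a single Kraus operator. -/
lemma overlap_bellOf_rectConj [DecidableEq β] (V N : Matrix β β ℂ) :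
    overlap (bellOf V) (tensorId (rectConj N) β (ketbra (bell β))) =
      ‖(Vᴴ * N).trace‖ ^ 2 / (Fintype.card β : ℝ) ^ 2 := by
  rw [tensorId_rectConj_ketbra_bell, overlap_ketbra, bellOf_eq, bellOf_eq, star_smul,
    smul_dotProduct, dotProduct_smul, star_rowVec_dotProduct, smul_smul, norm_smul, mul_pow,
    norm_mul, mul_pow, norm_star, norm_sqrt_card_inv_sq]
  field_simp

/-- This is what makes adding completely positive terms to a network harmless: they cannot lower the
fidelity. -/
lemma IsCompletelyPositive.overlap_nonneg [DecidableEq β] {Φ : Matrix β β ℂ →ₗ[ℂ] Matrix β β ℂ}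
    (hΦ : IsCompletelyPositive Φ) (V : Matrix β β ℂ) :
    0 ≤ overlap (bellOf V) (tensorId Φ β (ketbra (bell β))) := by
  obtain ⟨m, K, rfl⟩ := hΦ.exists_kraus
  rw [tensorId_sum, overlap_sum]
  refine Finset.sum_nonneg fun n _ => ?_
  rw [overlap_bellOf_rectConj]
  positivity

lemma frobSq_unitary [DecidableEq β] (W : Matrix.unitaryGroup β ℂ) :
    frobSq (W : Matrix β β ℂ) = Fintype.card β := by
  have h := trace_conjTranspose_mul (W : Matrix β β ℂ)
  rw [← Matrix.star_eq_conjTranspose, Matrix.UnitaryGroup.star_mul_self, Matrix.trace_one] at h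
  exact_mod_cast h.symm

lemma conjMap_eq_rectConj (W : Matrix α α ℂ) : conjMap W = rectConj W := rfl

lemma rectConj_comp {γ : Type*} [Fintype γ] (L : Matrix γ β ℂ) (K : Matrix β α ℂ) :
    rectConj L ∘ₗ rectConj K = rectConj (L * K) := by
  ext1 X
  simp [rectConj_apply, Matrix.mul_assoc]

lemma sum_comp_linearMap {α β γ ι : Type*} (s : Finset ι)
    (f : ι → Matrix β β ℂ →ₗ[ℂ] Matrix γ γ ℂ) (g : Matrix α α ℂ →ₗ[ℂ] Matrix β β ℂ) :
    (∑ i ∈ s, f i) ∘ₗ g = ∑ i ∈ s, f i ∘ₗ g := by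
  ext1 x
  simp [LinearMap.sum_apply]

lemma comp_sum_linearMap {α β γ ι : Type*} (s : Finset ι)
    (f : ι → Matrix α α ℂ →ₗ[ℂ] Matrix β β ℂ) (g : Matrix β β ℂ →ₗ[ℂ] Matrix γ γ ℂ) :
    g ∘ₗ (∑ i ∈ s, f i) = ∑ i ∈ s, g ∘ₗ f i := by
  ext1 x
  simp [LinearMap.sum_apply]

lemma network_kraus {ρ ι κ : Type*} [Fintype ρ] [DecidableEq ρ] [Fintype ι] [Fintype κ]
    (A : ι → Matrix (α × ρ) β ℂ) (B : κ → Matrix β (α × ρ) ℂ) (W : Matrix α α ℂ) :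
    network (∑ i, rectConj (A i)) (∑ l, rectConj (B l)) W =
      ∑ n : κ × ι, rectConj (B n.1 * (W ⊗ₖ (1 : Matrix ρ ρ ℂ)) * A n.2) := by
  rw [network, conjMap_eq_rectConj, comp_sum_linearMap, comp_sum_linearMap, Fintype.sum_prod_type,
    Finset.sum_comm]
  refine Finset.sum_congr rfl fun i _ => ?_
  rw [sum_comp_linearMap]
  refine Finset.sum_congr rfl fun l _ => ?_
  rw [rectConj_comp, rectConj_comp, Matrix.mul_assoc]

end Overlap

/-! ### Bell state conversion and the upper bound by gate teleportation. -/

section Bell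

variable {G : Type*} [Group G] [TopologicalSpace G] [CompactSpace G]
  [MeasurableSpace G] [BorelSpace G]
  {α β : Type*} [Fintype α] [DecidableEq α] [Fintype β] [DecidableEq β]

lemma continuous_coe_unitary {U : G →* Matrix.unitaryGroup α ℂ} (hU : Continuous U) :
    Continuous fun g => (U g : Matrix α α ℂ) := continuous_subtype_val.comp hU

lemma continuous_rowVec {f : G → Matrix β α ℂ} (hf : Continuous f) :
    Continuous fun g => rowVec (f g) :=
  continuous_pi fun p => hf.matrix_elem p.1 p.2

/-- The unnormalised overlap of `K |U g⟩⟩` with `|V g⟩⟩`. -/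
def bellAmp (U : G →* Matrix.unitaryGroup α ℂ) (V : G →* Matrix.unitaryGroup β ℂ)
    (K : Matrix (β × β) (α × α) ℂ) (g : G) : ℂ :=
  star (rowVec (V g : Matrix β β ℂ)) ⬝ᵥ (K *ᵥ rowVec (U g : Matrix α α ℂ))

/-- The unnormalised weight of `K |U g⟩⟩`. -/
noncomputable def bellWeight (U : G →* Matrix.unitaryGroup α ℂ)
    (K : Matrix (β × β) (α × α) ℂ) (g : G) : ℝ :=
  ∑ p, ‖(K *ᵥ rowVec (U g : Matrix α α ℂ)) p‖ ^ 2

lemma continuous_bellAmp {U : G →* Matrix.unitaryGroup α ℂ} {V : G →* Matrix.unitaryGroup β ℂ}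
    (hU : Continuous U) (hV : Continuous V) (K : Matrix (β × β) (α × α) ℂ) :
    Continuous (bellAmp U V K) := by
  have h1 := continuous_rowVec (continuous_coe_unitary hU)
  have h2 := continuous_rowVec (continuous_coe_unitary hV)
  exact h2.star.dotProduct (continuous_const.matrix_mulVec h1)

lemma continuous_bellWeight {U : G →* Matrix.unitaryGroup α ℂ}
    (hU : Continuous U) (K : Matrix (β × β) (α × α) ℂ) :
    Continuous (bellWeight U K) := by
  have h1 := continuous_rowVec (continuous_coe_unitary hU)
  have h2 : Continuous fun g => K *ᵥ rowVec (U g : Matrix α α ℂ) :=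
    continuous_const.matrix_mulVec h1
  exact continuous_finsetSum _ fun p _ => ((continuous_apply p).comp h2).norm.pow 2

/-- Cauchy–Schwarz, with `‖|V g⟩⟩‖² = d_out`; integrated, it bounds every conversion fidelity by 1.
-/
lemma bellAmp_sq_le (U : G →* Matrix.unitaryGroup α ℂ) (V : G →* Matrix.unitaryGroup β ℂ)
    (K : Matrix (β × β) (α × α) ℂ) (g : G) :
    ‖bellAmp U V K g‖ ^ 2 ≤ Fintype.card β * bellWeight U K g := by
  refine (norm_sum_mul_sq_le Finset.univ _ _).trans (le_of_eq ?_)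
  simp only [Pi.star_apply, norm_star]
  rw [sum_norm_rowVec_sq, frobSq_unitary, bellWeight]

lemma overlap_bell_kraus {ι : Type*} [Fintype ι] (U : G →* Matrix.unitaryGroup α ℂ)
    (V : G →* Matrix.unitaryGroup β ℂ) (K : ι → Matrix (β × β) (α × α) ℂ) (g : G) :
    overlap (bellOf (V g : Matrix β β ℂ))
      ((∑ n, rectConj (K n)) (ketbra (bellOf (U g : Matrix α α ℂ)))) =
    (1 / Fintype.card β) * (1 / Fintype.card α) * ∑ n, ‖bellAmp U V (K n) g‖ ^ 2 := by
  rw [LinearMap.sum_apply, overlap_sum, Finset.mul_sum]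
  refine Finset.sum_congr rfl fun n _ => ?_
  rw [rectConj_ketbra, overlap_ketbra, bellOf_eq, bellOf_eq, Matrix.mulVec_smul, star_smul,
    smul_dotProduct, dotProduct_smul, smul_smul, norm_smul, mul_pow, norm_mul, mul_pow, norm_star,
    norm_sqrt_card_inv_sq, norm_sqrt_card_inv_sq, bellAmp]

lemma trace_bell_kraus {ι : Type*} [Fintype ι] (U : G →* Matrix.unitaryGroup α ℂ)
    (K : ι → Matrix (β × β) (α × α) ℂ) (g : G) :
    ((∑ n, rectConj (K n)) (ketbra (bellOf (U g : Matrix α α ℂ)))).trace.re =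
    (1 / Fintype.card α) * ∑ n, bellWeight U (K n) g := by
  rw [LinearMap.sum_apply, Matrix.trace_sum, Complex.re_sum, Finset.mul_sum]
  refine Finset.sum_congr rfl fun n _ => ?_
  rw [rectConj_ketbra, trace_ketbra, bellOf_eq, Matrix.mulVec_smul, sum_norm_smul_sq,
    norm_sqrt_card_inv_sq, bellWeight]

variable (μ : Measure G) [IsProbabilityMeasure μ] [Nonempty α] [Nonempty β]
  {U : G →* Matrix.unitaryGroup α ℂ} {V : G →* Matrix.unitaryGroup β ℂ}

lemma bellSuccess_kraus (hU : Continuous U) {ι : Type*} [Fintype ι]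
    (K : ι → Matrix (β × β) (α × α) ℂ) :
    bellSuccess μ U (∑ n, rectConj (K n)) =
      (1 / Fintype.card α) * ∑ n, ∫ g, bellWeight U (K n) g ∂μ := by
  simp only [bellSuccess, trace_bell_kraus]
  rw [integral_const_mul, integral_finsetSum]
  exact fun n _ => integrable_of_continuous μ (continuous_bellWeight hU _)

lemma bellFidelity_kraus (hU : Continuous U) (hV : Continuous V) {ι : Type*} [Fintype ι]
    (K : ι → Matrix (β × β) (α × α) ℂ) :
    bellFidelity μ U V (∑ n, rectConj (K n)) =
      (∑ n, ∫ g, ‖bellAmp U V (K n) g‖ ^ 2 ∂μ) /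
        (Fintype.card β * ∑ n, ∫ g, bellWeight U (K n) g ∂μ) := by
  rw [bellFidelity, bellSuccess_kraus μ hU]
  simp only [overlap_bell_kraus]
  rw [integral_const_mul, integral_finsetSum]
  · have : (Fintype.card α : ℝ) ≠ 0 := by simp
    have : (Fintype.card β : ℝ) ≠ 0 := by simp
    field_simp
  · exact fun n _ => integrable_of_continuous μ ((continuous_bellAmp hU hV _).norm.pow 2)

lemma bellProbFidelities_le_one (hU : Continuous U) (hV : Continuous V) :
    ∀ F ∈ bellProbFidelities μ U V, F ≤ 1 := by
  rintro F ⟨M, hM, hpos, rfl⟩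
  obtain ⟨m, K, rfl⟩ := hM.completelyPositive.exists_kraus
  rw [bellFidelity_kraus μ hU hV]
  refine div_le_one_of_le₀ ?_ ?_
  · rw [Finset.mul_sum]
    refine Finset.sum_le_sum fun n _ => ?_
    rw [← integral_const_mul]
    exact integral_mono (integrable_of_continuous μ ((continuous_bellAmp hU hV _).norm.pow 2))
      ((integrable_of_continuous μ (continuous_bellWeight hU _)).const_mul _)
      fun g => bellAmp_sq_le U V (K n) g
  · refine mul_nonneg (by positivity) (Finset.sum_nonneg fun n _ => integral_nonneg fun g => ?_)
    exact Finset.sum_nonneg fun p _ => by positivity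

/-- A family of Kraus operators can be rescaled to a quantum operation without changing its
fidelity. -/
lemma kraus_mem_bellProbFidelities (hU : Continuous U) (hV : Continuous V) {ι : Type*} [Fintype ι]
    (K : ι → Matrix (β × β) (α × α) ℂ) (hpos : 0 < ∑ n, ∫ g, bellWeight U (K n) g ∂μ) :
    (∑ n, ∫ g, ‖bellAmp U V (K n) g‖ ^ 2 ∂μ) /
      (Fintype.card β * ∑ n, ∫ g, bellWeight U (K n) g ∂μ) ∈ bellProbFidelities μ U V := by
  set C : ℝ := ∑ n, frobSq (K n) with hC
  have hC0 : 0 ≤ C := Finset.sum_nonneg fun n _ => frobSq_nonneg _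
  -- The trace grows by at most the factor `C`, so scaling by `s² = 1 / (1 + C)` makes the map
  -- trace-non-increasing; the `1 +` avoids division by zero. The factor cancels in the fidelity.
  set s : ℝ := 1 / Real.sqrt (1 + C) with hs
  have hs2 : s ^ 2 = 1 / (1 + C) := by
    rw [hs, div_pow, Real.sq_sqrt (by positivity), one_pow]
  have hs2pos : 0 < s ^ 2 := by rw [hs2]; positivity
  have hnorm : ‖(s : ℂ)‖ ^ 2 = s ^ 2 := by simp
  have hamp : ∀ n g, ‖bellAmp U V ((s : ℂ) • K n) g‖ ^ 2 = s ^ 2 * ‖bellAmp U V (K n) g‖ ^ 2 := by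
    intro n g
    rw [bellAmp, Matrix.smul_mulVec, dotProduct_smul, norm_smul, mul_pow, hnorm, bellAmp]
  have hwt : ∀ n g, bellWeight U ((s : ℂ) • K n) g = s ^ 2 * bellWeight U (K n) g := by
    intro n g
    rw [bellWeight, Matrix.smul_mulVec, sum_norm_smul_sq, hnorm, bellWeight]
  refine ⟨∑ n, rectConj ((s : ℂ) • K n), ⟨?_, ?_⟩, ?_, ?_⟩
  · exact isCompletelyPositive_sum _ _ fun n _ => isCompletelyPositive_rectConj _
  · intro X hX
    obtain ⟨B, rfl⟩ := PosSemidef.exists_conjTranspose_mul_self hX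
    have hterm : ∀ n, (rectConj ((s : ℂ) • K n) (Bᴴ * B)).trace.re ≤
        s ^ 2 * frobSq (K n) * frobSq B := by
      intro n
      have : rectConj ((s : ℂ) • K n) (Bᴴ * B) = ((s : ℂ) ^ 2) • ((K n * Bᴴ) * (K n * Bᴴ)ᴴ) := by
        simp only [rectConj_apply, Matrix.conjTranspose_smul, Matrix.conjTranspose_mul,
          Matrix.conjTranspose_conjTranspose, Matrix.smul_mul, Matrix.mul_smul, smul_smul,
          Matrix.mul_assoc, Complex.star_def, Complex.conj_ofReal, sq]
      rw [this, Matrix.trace_smul, trace_mul_conjTranspose, smul_eq_mul]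
      norm_cast
      rw [mul_assoc]
      refine mul_le_mul_of_nonneg_left ?_ hs2pos.le
      exact (frobSq_mul_le _ _).trans_eq (by rw [frobSq_conjTranspose])
    rw [LinearMap.sum_apply, Matrix.trace_sum, Complex.re_sum, trace_conjTranspose_mul,
      Complex.ofReal_re]
    calc _ ≤ ∑ n, s ^ 2 * frobSq (K n) * frobSq B := Finset.sum_le_sum fun n _ => hterm n
      _ = C / (1 + C) * frobSq B := by
        rw [← Finset.sum_mul, ← Finset.mul_sum, ← hC, hs2]; ring
      _ ≤ 1 * frobSq B := by
        refine mul_le_mul_of_nonneg_right ?_ (frobSq_nonneg _)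
        rw [div_le_one (by positivity)]; linarith
      _ = frobSq B := one_mul _
  · rw [bellSuccess_kraus μ hU]
    simp only [hwt, integral_const_mul, ← Finset.mul_sum]
    positivity
  · rw [bellFidelity_kraus μ hU hV]
    simp only [hwt, hamp, integral_const_mul, ← Finset.mul_sum]
    rw [mul_left_comm, mul_div_mul_left _ _ hs2pos.ne']

/-- Gate teleportation: every deterministic simulation of `V g` yields a probabilistic conversion
of Bell states with the same fidelity. -/
lemma gateDetFidelities_subset (hU : Continuous U) (hV : Continuous V) :
    gateDetFidelities μ U V ⊆ bellProbFidelities μ U V := by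
  rintro F ⟨k, A, B, hA, hB, rfl⟩
  obtain ⟨a, KA, hKA⟩ := hA.completelyPositive.exists_kraus
  obtain ⟨b, KB, hKB⟩ := hB.completelyPositive.exists_kraus
  -- Contracting only the memory index `r` leaves the slot open; both legs of the slot become the
  -- input pair, to be filled by `|U g⟩⟩`.
  let K : Fin b × Fin a → Matrix (β × β) (α × α) ℂ := fun n =>
    Matrix.of fun p q => ∑ r, KB n.1 p.1 (q.1, r) * KA n.2 (q.2, r) p.2
  let N : Fin b × Fin a → G → Matrix β β ℂ := fun n g =>
    KB n.1 * ((U g : Matrix α α ℂ) ⊗ₖ (1 : Matrix (Fin k) (Fin k) ℂ)) * KA n.2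
  have hnet : ∀ g, network A B (U g : Matrix α α ℂ) = ∑ n, rectConj (N n g) := fun g => by
    rw [hKA, hKB, network_kraus]
  have hK : ∀ n g, K n *ᵥ rowVec (U g : Matrix α α ℂ) = rowVec (N n g) := by
    intro n g
    ext ⟨p, q⟩
    simp only [K, N, rowVec, Matrix.mulVec, dotProduct, Matrix.of_apply, Fintype.sum_prod_type,
      Matrix.mul_apply, Matrix.kroneckerMap_apply, Matrix.one_apply, mul_ite, mul_one, mul_zero,
      Finset.sum_ite_eq', Finset.mem_univ, if_true, Finset.sum_mul]
    rw [Finset.sum_comm]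
    refine Finset.sum_congr rfl fun x _ => ?_
    rw [Finset.sum_comm]
    refine Finset.sum_congr rfl fun r _ => Finset.sum_congr rfl fun y _ => ?_
    ring
  have hwt : ∀ g, ∑ n, bellWeight U (K n) g = Fintype.card β := by
    intro g
    -- The weights sum to the trace of the network's output on the identity, which trace
    -- preservation fixes for every `g`.
    have htr : (network A B (U g : Matrix α α ℂ) 1).trace = (1 : Matrix β β ℂ).trace := by
      rw [network, LinearMap.comp_apply, hB.trace_eq, LinearMap.comp_apply, conjMap_eq_rectConj,
        rectConj_apply, Matrix.trace_mul_cycle, Matrix.conjTranspose_kronecker,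
        ← Matrix.mul_kronecker_mul, ← Matrix.star_eq_conjTranspose,
        Matrix.UnitaryGroup.star_mul_self, Matrix.conjTranspose_one, Matrix.one_mul,
        Matrix.one_kronecker_one, Matrix.one_mul, hA.trace_eq]
    rw [hnet, LinearMap.sum_apply, Matrix.trace_sum, Matrix.trace_one] at htr
    simp only [rectConj_apply, Matrix.mul_one, trace_mul_conjTranspose] at htr
    simp only [bellWeight, hK, sum_norm_rowVec_sq]
    exact_mod_cast htr
  have hwt' : ∑ n, ∫ g, bellWeight U (K n) g ∂μ = Fintype.card β := by
    rw [← integral_finsetSum _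
      fun n _ => integrable_of_continuous μ (continuous_bellWeight hU _)]
    simp [hwt]
  have hmem := kraus_mem_bellProbFidelities μ hU hV K (by rw [hwt']; positivity)
  convert hmem using 1
  rw [hwt', gateFidelity, ← integral_finsetSum (f := fun n g => ‖bellAmp U V (K n) g‖ ^ 2) _
      fun n _ => integrable_of_continuous μ ((continuous_bellAmp hU hV _).norm.pow 2),
    ← integral_div]
  refine integral_congr_ae (Filter.Eventually.of_forall fun g => ?_)
  simp only [hnet, tensorId_sum, overlap_sum, overlap_bellOf_rectConj]
  rw [← Finset.sum_div, sq (Fintype.card β : ℝ)]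
  simp only [bellAmp, hK, star_rowVec_dotProduct]

end Bell

/-! ### Matrix-valued integrals over the group and averaged completely positive maps. -/

section MatrixIntegral

variable {G : Type*} [TopologicalSpace G] [CompactSpace G] [MeasurableSpace G] [BorelSpace G]
  (μ : Measure G) [IsProbabilityMeasure μ] {m n k : Type*}

/-- The entrywise integral of a matrix-valued function. -/
noncomputable def matInt (F : G → Matrix m n ℂ) : Matrix m n ℂ :=
  Matrix.of fun i j => ∫ g, F g i j ∂μ

lemma norm_integral_mul_sq_le {a b : G → ℂ} (ha : Continuous a) (hb : Continuous b) :
    ‖∫ g, a g * b g ∂μ‖ ^ 2 ≤ (∫ g, ‖a g‖ ^ 2 ∂μ) * ∫ g, ‖b g‖ ^ 2 ∂μ := by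
  have hmem : ∀ {f : G → ℂ}, Continuous f → MemLp f (ENNReal.ofReal 2) μ := fun hf =>
    hf.memLp_of_hasCompactSupport (HasCompactSupport.of_compactSpace _)
  have h := integral_mul_norm_le_Lp_mul_Lq (μ := μ) Real.HolderConjugate.two_two (hmem ha) (hmem hb)
  simp only [Real.rpow_two, ← Real.sqrt_eq_rpow] at h
  have h1 : ‖∫ g, a g * b g ∂μ‖ ≤ ∫ g, ‖a g‖ * ‖b g‖ ∂μ :=
    (norm_integral_le_integral_norm _).trans_eq (by simp)
  calc _ ≤ (Real.sqrt (∫ g, ‖a g‖ ^ 2 ∂μ) * Real.sqrt (∫ g, ‖b g‖ ^ 2 ∂μ)) ^ 2 := by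
        gcongr; exact h1.trans h
    _ = _ := by
        rw [mul_pow, Real.sq_sqrt (by positivity), Real.sq_sqrt (by positivity)]

variable {μ}

lemma matInt_add {F H : G → Matrix m n ℂ} (hF : Continuous F) (hH : Continuous H) :
    matInt μ (fun g => F g + H g) = matInt μ F + matInt μ H := by
  ext i j
  exact integral_add (integrable_of_continuous μ (hF.matrix_elem i j))
    (integrable_of_continuous μ (hH.matrix_elem i j))

lemma matInt_smul (c : ℂ) (F : G → Matrix m n ℂ) :
    matInt μ (fun g => c • F g) = c • matInt μ F := by
  ext i j
  exact integral_const_mul c _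

lemma matInt_conjTranspose (F : G → Matrix m n ℂ) :
    matInt μ (fun g => (F g)ᴴ) = (matInt μ F)ᴴ := by
  ext i j
  exact integral_conj

lemma matInt_mul_right [Fintype n] {F : G → Matrix m n ℂ} (hF : Continuous F) (B : Matrix n k ℂ) :
    matInt μ (fun g => F g * B) = matInt μ F * B := by
  ext i j
  simp only [matInt, Matrix.of_apply, Matrix.mul_apply]
  rw [integral_finsetSum]
  · exact Finset.sum_congr rfl fun l _ => integral_mul_const _ _
  · exact fun l _ => (integrable_of_continuous μ (hF.matrix_elem i l)).mul_const _

lemma matInt_mul_left [Fintype m] {F : G → Matrix m n ℂ} (hF : Continuous F) (A : Matrix k m ℂ) :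
    matInt μ (fun g => A * F g) = A * matInt μ F := by
  ext i j
  simp only [matInt, Matrix.of_apply, Matrix.mul_apply]
  rw [integral_finsetSum]
  · exact Finset.sum_congr rfl fun l _ => integral_const_mul _ _
  · exact fun l _ => (integrable_of_continuous μ (hF.matrix_elem l j)).const_mul _

lemma trace_matInt [Fintype n] {F : G → Matrix n n ℂ} (hF : Continuous F) :
    (matInt μ F).trace = ∫ g, (F g).trace ∂μ := by
  simp only [Matrix.trace, Matrix.diag_apply, matInt, Matrix.of_apply]
  rw [integral_finsetSum]
  exact fun l _ => integrable_of_continuous μ (hF.matrix_elem l l)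

lemma dotProduct_matInt_mulVec [Fintype m] [Fintype n] {F : G → Matrix m n ℂ} (hF : Continuous F)
    (x : m → ℂ) (y : n → ℂ) : x ⬝ᵥ (matInt μ F *ᵥ y) = ∫ g, x ⬝ᵥ (F g *ᵥ y) ∂μ := by
  have hc : ∀ i j, Integrable (fun g => x i * (F g i j * y j)) μ := fun i j =>
    ((integrable_of_continuous μ (hF.matrix_elem i j)).mul_const _).const_mul _
  simp only [dotProduct, Matrix.mulVec, Finset.mul_sum]
  rw [integral_finsetSum _ fun i _ => integrable_finsetSum _ fun j _ => hc i j]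
  refine Finset.sum_congr rfl fun i _ => ?_
  rw [integral_finsetSum _ fun j _ => hc i j]
  refine Finset.sum_congr rfl fun j _ => ?_
  rw [integral_const_mul, integral_mul_const, matInt, Matrix.of_apply]

lemma overlap_matInt [Fintype n] {F : G → Matrix n n ℂ} (hF : Continuous F) (ψ : n → ℂ) :
    overlap ψ (matInt μ F) = ∫ g, overlap ψ (F g) ∂μ := by
  rw [overlap, dotProduct_matInt_mulVec hF]
  exact (integral_re (𝕜 := ℂ) (integrable_of_continuous μ
    (continuous_const.dotProduct (hF.matrix_mulVec continuous_const)))).symm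

lemma posSemidef_matInt [Fintype n] {F : G → Matrix n n ℂ} (hF : Continuous F)
    (hpos : ∀ g, (F g).PosSemidef) : (matInt μ F).PosSemidef := by
  refine .of_dotProduct_mulVec_nonneg ?_ fun x => ?_
  · rw [Matrix.IsHermitian, ← matInt_conjTranspose]
    exact congrArg _ (funext fun g => (hpos g).1)
  · rw [dotProduct_matInt_mulVec hF]
    exact integral_nonneg fun g => (hpos g).dotProduct_mulVec_nonneg x

lemma matInt_mul_left_eq_self [Group G] [IsTopologicalGroup G] [μ.IsHaarMeasure]
    (F : G → Matrix m n ℂ) (h : G) : matInt μ (fun g => F (h * g)) = matInt μ F := by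
  ext i j
  exact integral_mul_left_eq_self (fun g => F g i j) h

variable {α β γ ρ : Type*} [Fintype α] [Fintype β] [Fintype γ] [Fintype ρ]

lemma continuous_rectConj {D : G → Matrix β γ ℂ} (hD : Continuous D) (X : Matrix γ γ ℂ) :
    Continuous fun g => rectConj (D g) X :=
  (hD.matrix_mul continuous_const).matrix_mul hD.matrix_conjTranspose

/-- The completely positive map `X ↦ ∫ D g X (D g)† dμ(g)`. -/
noncomputable def avgConj (D : G → Matrix β γ ℂ) (hD : Continuous D) (μ : Measure G)
    [IsProbabilityMeasure μ] :
    Matrix γ γ ℂ →ₗ[ℂ] Matrix β β ℂ where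
  toFun X := matInt μ fun g => rectConj (D g) X
  map_add' X Y := by
    simp only [map_add]
    exact matInt_add (continuous_rectConj hD X) (continuous_rectConj hD Y)
  map_smul' c X := by
    simp only [map_smul]
    exact matInt_smul c _

lemma tensorId_avgConj {D : G → Matrix β γ ℂ} (hD : Continuous D)
    (X : Matrix (γ × ρ) (γ × ρ) ℂ) :
    tensorId (avgConj D hD μ) ρ X = matInt μ fun g => tensorId (rectConj (D g)) ρ X := rfl

lemma continuous_tensorId_rectConj {D : G → Matrix β γ ℂ} (hD : Continuous D)
    (X : Matrix (γ × ρ) (γ × ρ) ℂ) : Continuous fun g => tensorId (rectConj (D g)) ρ X :=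
  continuous_matrix fun p q => (continuous_rectConj hD _).matrix_elem p.1 q.1

lemma isCompletelyPositive_avgConj {D : G → Matrix β γ ℂ} (hD : Continuous D) :
    IsCompletelyPositive (avgConj D hD μ) := fun k X hX =>
  posSemidef_matInt (continuous_tensorId_rectConj hD X)
    fun g => isCompletelyPositive_rectConj (D g) k X hX

/-- Identifies `∫ (D g)ᴴ * D g` as the effect whose bound by 1 says that the averaged map is
trace-non-increasing. -/
lemma trace_avgConj {D : G → Matrix β γ ℂ} (hD : Continuous D) (X : Matrix γ γ ℂ) :
    (avgConj D hD μ X).trace = (matInt μ (fun g => (D g)ᴴ * D g) * X).trace := by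
  rw [← matInt_mul_right (hD.matrix_conjTranspose.matrix_mul hD), trace_matInt
    ((hD.matrix_conjTranspose.matrix_mul hD).matrix_mul continuous_const)]
  exact (trace_matInt (continuous_rectConj hD X)).trans
    (integral_congr_ae (.of_forall fun g => Matrix.trace_mul_cycle _ _ _))

lemma avgConj_comp_rectConj {D : G → Matrix β γ ℂ} (hD : Continuous D) (K : Matrix γ α ℂ) :
    avgConj D hD μ ∘ₗ rectConj K =
      avgConj (fun g => D g * K) (hD.matrix_mul continuous_const) μ := by
  ext1 X
  change matInt μ (fun g => (rectConj (D g) ∘ₗ rectConj K) X) = _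
  simp only [rectConj_comp]
  rfl

end MatrixIntegral

/-! ### Completing an operation to a channel. -/

section Completion

variable {α β : Type*} [Fintype α] [Fintype β]

/-- With `M = Rᴴ * R`, prepare a fixed basis state `b` with weight `Tr (R X Rᴴ)`; the Kraus
operators are `|b⟩⟨i| R`. -/
lemma exists_isCompletelyPositive_trace [DecidableEq α] [Nonempty β] {M : Matrix α α ℂ}
    (hM : M.PosSemidef) :
    ∃ Φ : Matrix α α ℂ →ₗ[ℂ] Matrix β β ℂ, IsCompletelyPositive Φ ∧
      ∀ X, (Φ X).trace = (M * X).trace := by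
  classical
  obtain ⟨R, rfl⟩ := PosSemidef.exists_conjTranspose_mul_self hM
  let b : β := Classical.arbitrary β
  refine ⟨∑ i : α, rectConj (Matrix.single b i (1 : ℂ) * R),
    isCompletelyPositive_sum _ _ fun i _ => isCompletelyPositive_rectConj _, fun X => ?_⟩
  have h : ∀ i, (rectConj (Matrix.single b i (1 : ℂ) * R) X).trace = (R * X * Rᴴ) i i := by
    intro i
    rw [← rectConj_comp, LinearMap.comp_apply, rectConj_apply, rectConj_apply,
      Matrix.trace_mul_comm, ← Matrix.mul_assoc, Matrix.conjTranspose_single, star_one,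
      Matrix.single_mul_single_same, Matrix.trace_single_mul]
    simp
  simp only [LinearMap.sum_apply, Matrix.trace_sum, h]
  rw [Matrix.trace_mul_comm, ← Matrix.mul_assoc, Matrix.trace_mul_comm, ← Matrix.mul_assoc]
  rfl

/-- A completely positive trace-non-increasing map extends to a channel by adding a completely
positive map. -/
lemma exists_channel_completion [DecidableEq α] [Nonempty β]
    {Φ : Matrix α α ℂ →ₗ[ℂ] Matrix β β ℂ} (hΦ : IsCompletelyPositive Φ) {T : Matrix α α ℂ}
    (htr : ∀ X, (Φ X).trace = (T * X).trace) (hT : (1 - T).PosSemidef) :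
    ∃ Ψ : Matrix α α ℂ →ₗ[ℂ] Matrix β β ℂ, IsCompletelyPositive Ψ ∧ IsChannel (Φ + Ψ) := by
  obtain ⟨Ψ, hΨ, hΨtr⟩ := exists_isCompletelyPositive_trace (β := β) hT
  refine ⟨Ψ, hΨ, hΦ.add hΨ, fun X => ?_⟩
  rw [LinearMap.add_apply, Matrix.trace_add, htr, hΨtr, ← Matrix.trace_add, ← Matrix.add_mul,
    add_sub_cancel, Matrix.one_mul]

end Completion

/-! ### Gate fidelity achieved by a covariant decoder. -/

section Gate

variable {G : Type*} [Group G] [TopologicalSpace G] [CompactSpace G]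
  [MeasurableSpace G] [BorelSpace G]
  {α β : Type*} [Fintype α] [DecidableEq α] [Fintype β] [DecidableEq β] [Nonempty α] [Nonempty β]
  {μ : Measure G} [IsProbabilityMeasure μ]
  {U : G →* Matrix.unitaryGroup α ℂ} {V : G →* Matrix.unitaryGroup β ℂ}

lemma isCompletelyPositive_network {ρ : Type*} [Fintype ρ] [DecidableEq ρ]
    {A : Matrix β β ℂ →ₗ[ℂ] Matrix (α × ρ) (α × ρ) ℂ}
    {B : Matrix (α × ρ) (α × ρ) ℂ →ₗ[ℂ] Matrix β β ℂ}
    (hA : IsCompletelyPositive A) (hB : IsCompletelyPositive B) (W : Matrix α α ℂ) :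
    IsCompletelyPositive (network A B W) :=
  hB.comp ((isCompletelyPositive_rectConj _).comp hA)

lemma continuous_kronecker_one (hU : Continuous U) (ρ : Type*) [DecidableEq ρ] :
    Continuous fun g => (U g : Matrix α α ℂ) ⊗ₖ (1 : Matrix ρ ρ ℂ) :=
  continuous_matrix fun p q =>
    ((continuous_coe_unitary hU).matrix_elem p.1 q.1).mul continuous_const

lemma continuous_bellOf (hV : Continuous V) :
    Continuous fun g => bellOf (V g : Matrix β β ℂ) := by
  simp only [bellOf_eq]
  exact (continuous_rowVec (continuous_coe_unitary hV)).const_smul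
    ((1 / Real.sqrt (Fintype.card β) : ℝ) : ℂ)

lemma continuous_overlap_network (hU : Continuous U) (hV : Continuous V) {ρ : Type*} [Fintype ρ]
    [DecidableEq ρ] (A : Matrix β β ℂ →ₗ[ℂ] Matrix (α × ρ) (α × ρ) ℂ)
    (B : Matrix (α × ρ) (α × ρ) ℂ →ₗ[ℂ] Matrix β β ℂ) (X : Matrix (β × β) (β × β) ℂ) :
    Continuous fun g => overlap (bellOf (V g : Matrix β β ℂ))
      (tensorId (network A B (U g : Matrix α α ℂ)) β X) := by
  have h1 : ∀ Y, Continuous fun g => network A B (U g : Matrix α α ℂ) Y := fun Y =>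
    (LinearMap.continuous_of_finiteDimensional B).comp
      (continuous_rectConj (continuous_kronecker_one hU ρ) (A Y))
  have h2 : Continuous fun g => tensorId (network A B (U g : Matrix α α ℂ)) β X :=
    continuous_matrix fun p q => (h1 _).matrix_elem p.1 q.1
  exact Complex.continuous_re.comp
    ((continuous_bellOf hV).star.dotProduct (h2.matrix_mulVec (continuous_bellOf hV)))

/-- Trace-non-increasing devices do no better than channels. -/
lemma integral_overlap_network_le_gateDet (hbdd : BddAbove (gateDetFidelities μ U V))
    (hU : Continuous U) (hV : Continuous V) {k : ℕ} [NeZero k]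
    {A : Matrix β β ℂ →ₗ[ℂ] Matrix (α × Fin k) (α × Fin k) ℂ}
    {B : Matrix (α × Fin k) (α × Fin k) ℂ →ₗ[ℂ] Matrix β β ℂ}
    (hA : IsCompletelyPositive A) (hB : IsCompletelyPositive B)
    {S : Matrix β β ℂ} (hAtr : ∀ X, (A X).trace = (S * X).trace) (hS : (1 - S).PosSemidef)
    {T : Matrix (α × Fin k) (α × Fin k) ℂ} (hBtr : ∀ X, (B X).trace = (T * X).trace)
    (hT : (1 - T).PosSemidef) :
    ∫ g, overlap (bellOf (V g : Matrix β β ℂ))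
      (tensorId (network A B (U g : Matrix α α ℂ)) β (ketbra (bell β))) ∂μ ≤ gateDet μ U V := by
  obtain ⟨A', hA', hAA'⟩ := exists_channel_completion hA hAtr hS
  obtain ⟨B', hB', hBB'⟩ := exists_channel_completion hB hBtr hT
  refine le_trans ?_ (le_csSup hbdd ⟨k, A + A', B + B', hAA', hBB', rfl⟩)
  refine integral_mono (integrable_of_continuous μ (continuous_overlap_network hU hV _ _ _))
    (integrable_of_continuous μ (continuous_overlap_network hU hV _ _ _)) fun g => ?_
  -- Bilinearity in the two devices isolates the given network; the other terms are completely
  -- positive and contribute nonnegatively.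
  have hsplit : network (A + A') (B + B') (U g : Matrix α α ℂ) =
      network A B (U g : Matrix α α ℂ) +
        (network A B' (U g : Matrix α α ℂ) + network A' (B + B') (U g : Matrix α α ℂ)) := by
    simp only [network, LinearMap.add_comp, LinearMap.comp_add]
    abel
  simp only [hsplit]
  rw [tensorId_add, overlap_add]
  exact le_add_of_nonneg_right (((isCompletelyPositive_network hA hB' _).add
    (isCompletelyPositive_network hA' (hB.add hB') _)).overlap_nonneg _)

/-- A lower bound on the fidelity achieved by a contraction `E` as encoder and the operations `D g`
as decoder. -/
lemma le_gateDet_of_le_integral_trace_sq (hbdd : BddAbove (gateDetFidelities μ U V))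
    (hU : Continuous U) (hV : Continuous V) {ρ : Type*} [Fintype ρ] [DecidableEq ρ] [Nonempty ρ]
    (E : Matrix (α × ρ) β ℂ) (hE : (1 - Eᴴ * E).PosSemidef) {D : G → Matrix β (α × ρ) ℂ}
    (hD : Continuous D) (hT : (1 - matInt μ fun g => (D g)ᴴ * D g).PosSemidef)
    {c : ℝ} (hc : ∀ h, c ≤ (∫ g, ‖((V h : Matrix β β ℂ)ᴴ *
      (D g * ((U h : Matrix α α ℂ) ⊗ₖ (1 : Matrix ρ ρ ℂ)) * E)).trace‖ ^ 2 ∂μ) /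
        (Fintype.card β : ℝ) ^ 2) : c ≤ gateDet μ U V := by
  -- Admissible memories are indexed by `Fin k`, so everything is transported along a bijection with
  -- `ρ`.
  let k := Fintype.card ρ
  have : NeZero k := ⟨Fintype.card_ne_zero⟩
  let e : Fin k ≃ ρ := (Fintype.equivFin ρ).symm
  let σ : α × Fin k ≃ α × ρ := (Equiv.refl α).prodCongr e
  let E' : Matrix (α × Fin k) β ℂ := E.submatrix σ id
  let D' : G → Matrix β (α × Fin k) ℂ := fun g => (D g).submatrix id σ
  have hD' : Continuous D' := hD.matrix_submatrix _ _
  have hE' : E'ᴴ * E' = Eᴴ * E := by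
    simp only [E', Matrix.conjTranspose_submatrix, Matrix.submatrix_mul_equiv,
      Matrix.submatrix_id_id]
  have hT' : (matInt μ fun g => (D' g)ᴴ * D' g) =
      (matInt μ fun g => (D g)ᴴ * D g).submatrix σ σ := by
    ext i j
    rfl
  have hW : ∀ h, ((U h : Matrix α α ℂ) ⊗ₖ (1 : Matrix (Fin k) (Fin k) ℂ)) =
      ((U h : Matrix α α ℂ) ⊗ₖ (1 : Matrix ρ ρ ℂ)).submatrix σ σ := by
    intro h
    ext ⟨a, r⟩ ⟨b, s⟩
    simp [σ, Matrix.kroneckerMap_apply, Matrix.one_apply]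
  have hmul : ∀ h g, D' g * ((U h : Matrix α α ℂ) ⊗ₖ (1 : Matrix (Fin k) (Fin k) ℂ)) * E' =
      D g * ((U h : Matrix α α ℂ) ⊗ₖ (1 : Matrix ρ ρ ℂ)) * E := by
    intro h g
    simp only [D', E', hW, Matrix.submatrix_mul_equiv, Matrix.submatrix_id_id]
  refine le_trans ?_ (integral_overlap_network_le_gateDet hbdd hU hV
    (isCompletelyPositive_rectConj E') (isCompletelyPositive_avgConj hD')
    (fun X => (Matrix.trace_mul_cycle _ _ _)) (by rwa [hE'])
    (trace_avgConj hD') (by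
      have := hT.submatrix σ
      rw [hT']
      rwa [Matrix.submatrix_sub, Pi.sub_apply, Pi.sub_apply, Matrix.submatrix_one_equiv] at this))
  have hconst : c = ∫ _ : G, c ∂μ := by simp
  rw [hconst]
  refine integral_mono (integrable_const c)
    (integrable_of_continuous μ (continuous_overlap_network hU hV _ _ _)) fun h => ?_
  refine (hc h).trans_eq ?_
  simp only [network, conjMap_eq_rectConj, rectConj_comp, avgConj_comp_rectConj]
  rw [tensorId_avgConj, overlap_matInt (continuous_tensorId_rectConj
    (hD'.matrix_mul continuous_const) _)]
  simp only [overlap_bellOf_rectConj, ← Matrix.mul_assoc, ← integral_div]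
  refine integral_congr_ae (.of_forall fun g => ?_)
  have := hmul h g
  simp only [Matrix.mul_assoc] at this ⊢
  rw [this]

variable [IsTopologicalGroup G] [μ.IsHaarMeasure]

/-- Cauchy–Schwarz followed by the arithmetic–geometric mean inequality, in a form that can be
integrated pointwise. -/
lemma re_mul_star_dotProduct_le {n : Type*} [Fintype n] (c : ℂ) (z x : n → ℂ) :
    (c * (star z ⬝ᵥ x)).re ≤ ((∑ i, ‖z i‖ ^ 2) + ‖c‖ ^ 2 * ∑ i, ‖x i‖ ^ 2) / 2 := by
  have h : ‖star z ⬝ᵥ x‖ ^ 2 ≤ (∑ i, ‖z i‖ ^ 2) * ∑ i, ‖x i‖ ^ 2 :=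
    (norm_sum_mul_sq_le Finset.univ _ _).trans_eq (by simp)
  have hz : 0 ≤ ∑ i, ‖z i‖ ^ 2 := by positivity
  have hx : 0 ≤ ∑ i, ‖x i‖ ^ 2 := by positivity
  refine (Complex.re_le_norm _).trans (abs_le_of_sq_le_sq' ?_ (by positivity)).2
  rw [norm_mul, mul_pow]
  have := mul_le_mul_of_nonneg_left h (sq_nonneg ‖c‖)
  nlinarith [sq_nonneg ((∑ i, ‖z i‖ ^ 2) - ‖c‖ ^ 2 * ∑ i, ‖x i‖ ^ 2)]

lemma star_dotProduct_self_eq {n : Type*} [Fintype n] (x : n → ℂ) :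
    star x ⬝ᵥ x = ((∑ i, ‖x i‖ ^ 2 : ℝ) : ℂ) := by
  simp [dotProduct, Complex.conj_mul']

lemma posSemidef_one_sub_conjTranspose_mul {m n : Type*} [Fintype m] [Fintype n] [DecidableEq n]
    {E : Matrix m n ℂ} (h : ∀ x, ∑ i, ‖(E *ᵥ x) i‖ ^ 2 ≤ ∑ i, ‖x i‖ ^ 2) :
    (1 - Eᴴ * E).PosSemidef := by
  refine .of_dotProduct_mulVec_nonneg ?_ fun x => ?_
  · exact Matrix.isHermitian_one.sub (Matrix.isHermitian_conjTranspose_mul_self E)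
  · rw [Matrix.sub_mulVec, Matrix.one_mulVec, dotProduct_sub, ← Matrix.mulVec_mulVec,
      Matrix.dotProduct_mulVec, ← Matrix.star_mulVec, star_dotProduct_self_eq,
      star_dotProduct_self_eq, ← Complex.ofReal_sub]
    exact_mod_cast sub_nonneg.mpr (h x)

/-- Shows that the encoder is a contraction after division by `√N`. For `y` the image of `x`, `‖y‖²
= ∫ Re f ⟨D y, x⟩ ≤ (∫ ‖D y‖² + ∫ |f|² ‖x‖²) / 2`; since `∫ ‖D y‖² ≤ ‖y‖²`, half of `‖y‖²` is
absorbed on the left. -/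
lemma sum_norm_matInt_smul_mulVec_le {m n : Type*} [Fintype m] [Fintype n] [DecidableEq m]
    {D : G → Matrix n m ℂ} (hD : Continuous D)
    (hT : (1 - matInt μ fun g => (D g)ᴴ * D g).PosSemidef) {f : G → ℂ} (hf : Continuous f)
    (x : n → ℂ) :
    ∑ i, ‖((matInt μ fun g => f g • (D g)ᴴ) *ᵥ x) i‖ ^ 2 ≤
      (∫ g, ‖f g‖ ^ 2 ∂μ) * ∑ i, ‖x i‖ ^ 2 := by
  set y := (matInt μ fun g => f g • (D g)ᴴ) *ᵥ x with hy
  have hfD : Continuous fun g => f g • (D g)ᴴ := hf.smul hD.matrix_conjTranspose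
  have hc1 : Continuous fun g => D g *ᵥ y := hD.matrix_mulVec continuous_const
  have hc2 : Continuous fun g => ∑ i, ‖(D g *ᵥ y) i‖ ^ 2 :=
    continuous_finsetSum _ fun i _ => ((continuous_apply i).comp hc1).norm.pow 2
  have hc3 : Continuous fun g => ‖f g‖ ^ 2 * ∑ i, ‖x i‖ ^ 2 :=
    (hf.norm.pow 2).mul continuous_const
  have h1 : ∑ i, ‖y i‖ ^ 2 = ∫ g, (f g * (star (D g *ᵥ y) ⬝ᵥ x)).re ∂μ := by
    have h : star y ⬝ᵥ y = ∫ g, f g * (star (D g *ᵥ y) ⬝ᵥ x) ∂μ := by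
      have h0 := dotProduct_matInt_mulVec (μ := μ) hfD (star y) x
      rw [← hy] at h0
      rw [h0]
      refine integral_congr_ae (.of_forall fun g => ?_)
      simp only
      rw [Matrix.smul_mulVec, dotProduct_smul, smul_eq_mul, Matrix.dotProduct_mulVec,
        Matrix.star_mulVec (D g) y]
    rw [star_dotProduct_self_eq] at h
    rw [← Complex.ofReal_re (∑ i, ‖y i‖ ^ 2), h]
    exact (integral_re (𝕜 := ℂ) (integrable_of_continuous μ
      (hf.mul (hc1.star.dotProduct continuous_const)))).symm
  have h2 : ∫ g, ∑ i, ‖(D g *ᵥ y) i‖ ^ 2 ∂μ ≤ ∑ i, ‖y i‖ ^ 2 := by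
    have h := hT.dotProduct_mulVec_nonneg y
    rw [Matrix.sub_mulVec, Matrix.one_mulVec, dotProduct_sub,
      dotProduct_matInt_mulVec (hD.matrix_conjTranspose.matrix_mul hD),
      star_dotProduct_self_eq] at h
    have h' : ∀ g, star y ⬝ᵥ (((D g)ᴴ * D g) *ᵥ y) = ((∑ i, ‖(D g *ᵥ y) i‖ ^ 2 : ℝ) : ℂ) := by
      intro g
      rw [← Matrix.mulVec_mulVec, Matrix.dotProduct_mulVec, ← Matrix.star_mulVec,
        star_dotProduct_self_eq]
    simp only [h'] at h
    rw [integral_complex_ofReal, ← Complex.ofReal_sub] at h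
    exact sub_nonneg.mp (by exact_mod_cast h)
  have h3 : ∫ g, (f g * (star (D g *ᵥ y) ⬝ᵥ x)).re ∂μ ≤
      ∫ g, ((∑ i, ‖(D g *ᵥ y) i‖ ^ 2) + ‖f g‖ ^ 2 * ∑ i, ‖x i‖ ^ 2) / 2 ∂μ :=
    integral_mono (integrable_of_continuous μ (Complex.continuous_re.comp
        (hf.mul (hc1.star.dotProduct continuous_const))))
      (integrable_of_continuous μ ((hc2.add hc3).div_const 2))
      fun g => re_mul_star_dotProduct_le _ _ _
  rw [integral_div, integral_add (integrable_of_continuous μ hc2)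
    (integrable_of_continuous μ hc3), integral_mul_const] at h3
  linarith

/-- The fidelity achieved by a covariant decoder `D` and the encoder `∫ f g (D g)† dμ(g)`. -/
lemma frobSq_matInt_div_sq_le_gateDet (hbdd : BddAbove (gateDetFidelities μ U V))
    (hU : Continuous U) (hV : Continuous V) {ρ : Type*} [Fintype ρ] [DecidableEq ρ] [Nonempty ρ]
    {D : G → Matrix β (α × ρ) ℂ} (hD : Continuous D)
    (hT : (1 - matInt μ fun g => (D g)ᴴ * D g).PosSemidef)
    (hcov : ∀ h g, D (h * g) = (V h : Matrix β β ℂ) * D g *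
      ((U h : Matrix α α ℂ) ⊗ₖ (1 : Matrix ρ ρ ℂ))ᴴ)
    {f : G → ℂ} (hf : Continuous f) (hN : 0 < ∫ g, ‖f g‖ ^ 2 ∂μ) :
    (frobSq (matInt μ fun g => f g • (D g)ᴴ) /
      ((∫ g, ‖f g‖ ^ 2 ∂μ) * Fintype.card β)) ^ 2 ≤ gateDet μ U V := by
  set N := ∫ g, ‖f g‖ ^ 2 ∂μ with hNdef
  set L := matInt μ fun g => f g • (D g)ᴴ with hL
  set E : Matrix (α × ρ) β ℂ := ((1 / Real.sqrt N : ℝ) : ℂ) • L with hEdef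
  have hnorm : ‖((1 / Real.sqrt N : ℝ) : ℂ)‖ ^ 2 = 1 / N := by
    rw [Complex.norm_real, Real.norm_eq_abs, sq_abs, div_pow, Real.sq_sqrt hN.le, one_pow]
  have hE : (1 - Eᴴ * E).PosSemidef := by
    refine posSemidef_one_sub_conjTranspose_mul fun x => ?_
    rw [hEdef, Matrix.smul_mulVec, sum_norm_smul_sq, hnorm]
    have := sum_norm_matInt_smul_mulVec_le hD hT hf x
    rw [← hL, ← hNdef] at this
    rw [one_div, inv_mul_le_iff₀ hN]
    exact this
  have key : ∀ h, (frobSq L / N) ^ 2 ≤ ∫ g, ‖((V h : Matrix β β ℂ)ᴴ *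
      (D g * ((U h : Matrix α α ℂ) ⊗ₖ (1 : Matrix ρ ρ ℂ)) * E)).trace‖ ^ 2 ∂μ := by
    intro h
    set W := (U h : Matrix α α ℂ) ⊗ₖ (1 : Matrix ρ ρ ℂ) with hW
    have hWW : Wᴴ * W = 1 := by
      rw [hW, Matrix.conjTranspose_kronecker, ← Matrix.mul_kronecker_mul,
        ← Matrix.star_eq_conjTranspose, Matrix.UnitaryGroup.star_mul_self,
        Matrix.conjTranspose_one, Matrix.one_mul, Matrix.one_kronecker_one]
    have hVV : (V h : Matrix β β ℂ)ᴴ * (V h : Matrix β β ℂ) = 1 := by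
      rw [← Matrix.star_eq_conjTranspose, Matrix.UnitaryGroup.star_mul_self]
    have hfc : Continuous fun g => f (h⁻¹ * g) := hf.comp (continuous_const.mul continuous_id)
    have hfD : Continuous fun g => f g • (D g)ᴴ := hf.smul hD.matrix_conjTranspose
    have hfcD : Continuous fun g => f (h⁻¹ * g) • (D g)ᴴ := hfc.smul hD.matrix_conjTranspose
    have hfcD' : Continuous fun g => (f (h⁻¹ * g) • (D g)ᴴ)ᴴ := hfcD.matrix_conjTranspose
    set L' := matInt μ fun g => f (h⁻¹ * g) • (D g)ᴴ with hL'
    -- By covariance and Haar invariance, passing `W` through `L` produces `V h` and only translates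
    -- `f`.
    have hWL : W * L = L' * (V h : Matrix β β ℂ) := by
      rw [hL, ← matInt_mul_left hfD, hL',
        ← matInt_mul_right hfcD,
        ← matInt_mul_left_eq_self (fun g => (f (h⁻¹ * g) • (D g)ᴴ) * (V h : Matrix β β ℂ)) h]
      refine congrArg (matInt μ) (funext fun g => ?_)
      rw [inv_mul_cancel_left, hcov, Matrix.conjTranspose_mul, Matrix.conjTranspose_conjTranspose,
        Matrix.conjTranspose_mul, Matrix.smul_mul, Matrix.mul_smul, Matrix.mul_assoc,
        Matrix.mul_assoc, hVV, Matrix.mul_one]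
    have hfrob : ((L'ᴴ) * (W * E) * (V h : Matrix β β ℂ)ᴴ).trace =
        ((1 / Real.sqrt N : ℝ) : ℂ) * (frobSq L : ℂ) := by
      rw [Matrix.trace_mul_comm, ← Matrix.mul_assoc, ← Matrix.conjTranspose_mul, ← hWL, hEdef,
        Matrix.mul_smul, Matrix.mul_smul, Matrix.trace_smul, smul_eq_mul,
        Matrix.conjTranspose_mul, Matrix.mul_assoc, ← Matrix.mul_assoc Wᴴ, hWW, Matrix.one_mul,
        trace_conjTranspose_mul]
    have hDc : Continuous fun g => D g * W * E :=
      (hD.matrix_mul continuous_const).matrix_mul continuous_const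
    have hm : Continuous fun g => ((V h : Matrix β β ℂ)ᴴ * (D g * W * E)).trace :=
      (continuous_const.matrix_mul hDc).matrix_trace
    -- Testing the decoder traces against the translated `f` reassembles `L'`, so the result no
    -- longer depends on `h`.
    have hint : ∫ g, star (f (h⁻¹ * g)) * ((V h : Matrix β β ℂ)ᴴ * (D g * W * E)).trace ∂μ =
        ((1 / Real.sqrt N : ℝ) : ℂ) * (frobSq L : ℂ) := by
      rw [← hfrob, hL', ← matInt_conjTranspose,
        ← matInt_mul_right hfcD', ← matInt_mul_right (hfcD'.matrix_mul continuous_const),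
        trace_matInt ((hfcD'.matrix_mul continuous_const).matrix_mul continuous_const)]
      refine integral_congr_ae (.of_forall fun g => ?_)
      simp only [Matrix.conjTranspose_smul, Matrix.conjTranspose_conjTranspose, Matrix.smul_mul,
        Matrix.trace_smul, smul_eq_mul]
      rw [Matrix.trace_mul_comm, Matrix.mul_assoc (D g) W E]
    -- Cauchy–Schwarz over `G`: the translated `f` still has squared norm `N`, and a second factor
    -- `1 / N` comes from normalising `E`.
    have hcs := norm_integral_mul_sq_le μ hfc.star hm
    rw [hint, norm_mul, mul_pow, hnorm, Complex.norm_real, Real.norm_eq_abs, sq_abs] at hcs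
    simp only [norm_star] at hcs
    rw [integral_mul_left_eq_self (fun g => ‖f g‖ ^ 2) h⁻¹, ← hNdef] at hcs
    rw [div_pow, div_le_iff₀ (by positivity)]
    rw [one_div, inv_mul_le_iff₀ hN] at hcs
    nlinarith
  refine le_gateDet_of_le_integral_trace_sq hbdd hU hV E hE hD hT fun h => ?_
  rw [← div_div, div_pow _ (Fintype.card β : ℝ)]
  exact div_le_div_of_nonneg_right (key h) (by positivity)

end Gate

/-! ### Pretty good measurement decoder and the bound for one Kraus operator. -/

open scoped MatrixOrder in
/-- A positive definite matrix has an invertible Hermitian square root whose inverse commutes with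
everything the matrix commutes with. -/
lemma PosDef.exists_sqrt {n : Type*} [Fintype n] [DecidableEq n] {M : Matrix n n ℂ}
    (hM : M.PosDef) : ∃ r q : Matrix n n ℂ, r * r = M ∧ r * q = 1 ∧ q * r = 1 ∧ rᴴ = r ∧ qᴴ = q ∧
      ∀ W, Commute M W → Commute q W := by
  have hM0 : 0 ≤ M := hM.posSemidef.nonneg
  have hrr : CFC.sqrt M * CFC.sqrt M = M := CFC.sqrt_mul_sqrt_self M hM0
  have hr : (CFC.sqrt M)ᴴ = CFC.sqrt M := (Matrix.nonneg_iff_posSemidef.mp (CFC.sqrt_nonneg M)).1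
  have hdet : IsUnit (CFC.sqrt M).det := by
    have h := (Matrix.isUnit_iff_isUnit_det _).mp hM.isUnit
    rw [← hrr, Matrix.det_mul] at h
    exact isUnit_of_mul_isUnit_left h
  refine ⟨CFC.sqrt M, (CFC.sqrt M)⁻¹, hrr, Matrix.mul_nonsing_inv _ hdet,
    Matrix.nonsing_inv_mul _ hdet, hr, ?_, fun W hW => ?_⟩
  · rw [Matrix.conjTranspose_nonsing_inv, hr]
  · have h : Commute (CFC.sqrt M) W := hW.cfcₙ_nnreal _
    have h1 := Matrix.nonsing_inv_mul _ hdet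
    have h2 := Matrix.mul_nonsing_inv _ hdet
    calc (CFC.sqrt M)⁻¹ * W = (CFC.sqrt M)⁻¹ * (W * CFC.sqrt M) * (CFC.sqrt M)⁻¹ := by
          rw [Matrix.mul_assoc, Matrix.mul_assoc W, h2, Matrix.mul_one]
      _ = W * (CFC.sqrt M)⁻¹ := by
          rw [← h.eq, ← Matrix.mul_assoc, h1, Matrix.one_mul]

section Lower

variable {G : Type*} [Group G] [TopologicalSpace G] [CompactSpace G]
  [MeasurableSpace G] [BorelSpace G]
  {α β : Type*} [Fintype α] [DecidableEq α] [Fintype β] [DecidableEq β] [Nonempty α] [Nonempty β]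
  {μ : Measure G} [IsProbabilityMeasure μ]
  {U : G →* Matrix.unitaryGroup α ℂ} {V : G →* Matrix.unitaryGroup β ℂ}

/-- The average of `|U g⟩⟩⟨⟨U g|`. -/
noncomputable def gram (μ : Measure G) (U : G →* Matrix.unitaryGroup α ℂ) :
    Matrix (α × α) (α × α) ℂ := matInt μ fun g => ketbra (rowVec (U g : Matrix α α ℂ))

lemma continuous_ketbra {n : Type*} {v : G → n → ℂ} (hv : Continuous v) :
    Continuous fun g => ketbra (v g) :=
  continuous_matrix fun i j =>
    ((continuous_apply i).comp hv).mul ((continuous_apply j).comp hv).star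

lemma posSemidef_gram (hU : Continuous U) : (gram μ U).PosSemidef :=
  posSemidef_matInt (continuous_ketbra (continuous_rowVec (continuous_coe_unitary hU)))
    fun _ => Matrix.posSemidef_vecMulVec_self_star _

lemma kronecker_one_mulVec_rowVec (h g : G) :
    rowVec (U (h * g) : Matrix α α ℂ) =
      ((U h : Matrix α α ℂ) ⊗ₖ (1 : Matrix α α ℂ)) *ᵥ rowVec (U g : Matrix α α ℂ) := by
  ext ⟨i, j⟩
  simp [rowVec, Matrix.mulVec, dotProduct, Fintype.sum_prod_type, Matrix.one_apply,
    Matrix.mul_apply]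

lemma kronecker_one_conjTranspose_mul_self {σ : Type*} [Fintype σ] [DecidableEq σ] (h : G) :
    ((U h : Matrix α α ℂ) ⊗ₖ (1 : Matrix σ σ ℂ))ᴴ * ((U h : Matrix α α ℂ) ⊗ₖ (1 : Matrix σ σ ℂ)) =
      1 := by
  rw [Matrix.conjTranspose_kronecker, ← Matrix.mul_kronecker_mul, ← Matrix.star_eq_conjTranspose,
    Matrix.UnitaryGroup.star_mul_self, Matrix.conjTranspose_one, Matrix.one_mul,
    Matrix.one_kronecker_one]

/-- Translating the Haar average by `h` conjugates it by `U h ⊗ 1`. This passes to `q` and makes the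
decoder covariant. -/
lemma commute_gram [IsTopologicalGroup G] [μ.IsHaarMeasure] (hU : Continuous U) (h : G) :
    Commute (gram μ U) ((U h : Matrix α α ℂ) ⊗ₖ (1 : Matrix α α ℂ)) := by
  set W := (U h : Matrix α α ℂ) ⊗ₖ (1 : Matrix α α ℂ) with hW
  have hc := continuous_ketbra (continuous_rowVec (continuous_coe_unitary hU))
  have hconj : gram μ U = W * gram μ U * Wᴴ := by
    conv_lhs => rw [gram, ← matInt_mul_left_eq_self _ h]
    rw [gram, ← matInt_mul_left hc, ← matInt_mul_right (continuous_const.matrix_mul hc)]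
    refine congrArg (matInt μ) (funext fun g => ?_)
    rw [kronecker_one_mulVec_rowVec, ← rectConj_ketbra, rectConj_apply]
  rw [Commute, SemiconjBy]
  conv_lhs => rw [hconj]
  rw [Matrix.mul_assoc, kronecker_one_conjTranspose_mul_self, Matrix.mul_one]

lemma trace_mul_gram_mul (hU : Continuous U) (K : Matrix (β × β) (α × α) ℂ) :
    (K * gram μ U * Kᴴ).trace = ((∫ g, bellWeight U K g ∂μ : ℝ) : ℂ) := by
  have hc := continuous_ketbra (continuous_rowVec (continuous_coe_unitary hU))
  rw [gram, ← matInt_mul_left hc, ← matInt_mul_right (continuous_const.matrix_mul hc),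
    trace_matInt ((continuous_const.matrix_mul hc).matrix_mul continuous_const),
    ← integral_complex_ofReal]
  refine integral_congr_ae (.of_forall fun g => ?_)
  simp only
  rw [← rectConj_apply, rectConj_ketbra, bellWeight, ← star_dotProduct_self_eq, ketbra,
    Matrix.trace_vecMulVec, dotProduct_comm]

/-- The decoder that measures `|q U g⟩⟩` on the first two systems and applies `V g` to the third. -/
def measureDecoder (U : G →* Matrix.unitaryGroup α ℂ) (V : G →* Matrix.unitaryGroup β ℂ)
    (q : Matrix (α × α) (α × α) ℂ) (g : G) : Matrix β (α × (α × β)) ℂ :=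
  Matrix.of fun c p => star ((q *ᵥ rowVec (U g : Matrix α α ℂ)) (p.1, p.2.1)) *
    (V g : Matrix β β ℂ) c p.2.2

lemma continuous_measureDecoder (hU : Continuous U) (hV : Continuous V)
    (q : Matrix (α × α) (α × α) ℂ) : Continuous (measureDecoder U V q) := by
  have hu : Continuous fun g => q *ᵥ rowVec (U g : Matrix α α ℂ) :=
    continuous_const.matrix_mulVec (continuous_rowVec (continuous_coe_unitary hU))
  exact continuous_matrix fun c p =>
    ((continuous_apply _).comp hu).star.mul ((continuous_coe_unitary hV).matrix_elem c p.2.2)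

lemma measureDecoder_mul {q : Matrix (α × α) (α × α) ℂ} {h : G}
    (hq : Commute q ((U h : Matrix α α ℂ) ⊗ₖ (1 : Matrix α α ℂ))) (g : G) :
    measureDecoder U V q (h * g) = (V h : Matrix β β ℂ) * measureDecoder U V q g *
      ((U h : Matrix α α ℂ) ⊗ₖ (1 : Matrix (α × β) (α × β) ℂ))ᴴ := by
  ext c ⟨a, s, b⟩
  have h1 : (q *ᵥ rowVec (U (h * g) : Matrix α α ℂ)) (a, s) =
      ∑ a', (U h : Matrix α α ℂ) a a' * (q *ᵥ rowVec (U g : Matrix α α ℂ)) (a', s) := by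
    rw [kronecker_one_mulVec_rowVec, Matrix.mulVec_mulVec, hq.eq, ← Matrix.mulVec_mulVec]
    generalize q *ᵥ rowVec (U g : Matrix α α ℂ) = v
    simp [Matrix.mulVec, dotProduct, Fintype.sum_prod_type, Matrix.one_apply]
  have h2 : (V (h * g) : Matrix β β ℂ) c b =
      ∑ d, (V h : Matrix β β ℂ) c d * (V g : Matrix β β ℂ) d b := by
    rw [map_mul]; rfl
  have h3 : ∀ c (X : Matrix β (α × (α × β)) ℂ), (X *
      ((U h : Matrix α α ℂ) ⊗ₖ (1 : Matrix (α × β) (α × β) ℂ))ᴴ) c (a, s, b) =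
        ∑ a', X c (a', s, b) * star ((U h : Matrix α α ℂ) a a') := by
    intro c X
    rw [Matrix.mul_apply, Fintype.sum_prod_type]
    refine Finset.sum_congr rfl fun a' _ => ?_
    rw [Finset.sum_eq_single (s, b)]
    · simp [Matrix.kroneckerMap_apply]
    · intro p _ hp
      simp [Matrix.kroneckerMap_apply, Matrix.one_apply_ne hp.symm]
    · simp
  rw [h3]
  simp only [measureDecoder, Matrix.of_apply, Matrix.mul_apply]
  rw [h1, h2]
  simp only [star_sum, star_mul', Finset.sum_mul, Finset.mul_sum]
  rw [Finset.sum_comm]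
  refine Finset.sum_congr rfl fun x _ => Finset.sum_congr rfl fun y _ => ?_
  ring

/-- In `(D g)ᴴ * D g` the factor `V g` cancels by unitarity, leaving only the measurement on the
first two systems. -/
lemma matInt_measureDecoder (hU : Continuous U) {q : Matrix (α × α) (α × α) ℂ} (hq : qᴴ = q) :
    (matInt μ fun g => (measureDecoder U V q g)ᴴ * measureDecoder U V q g) =
      ((q * gram μ U * q) ⊗ₖ (1 : Matrix β β ℂ)).submatrix
        (Equiv.prodAssoc α α β).symm (Equiv.prodAssoc α α β).symm := by
  have hc := continuous_ketbra (continuous_rowVec (continuous_coe_unitary hU))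
  have h1 : q * gram μ U * q = matInt μ fun g => ketbra (q *ᵥ rowVec (U g : Matrix α α ℂ)) := by
    rw [gram, ← matInt_mul_left hc, ← matInt_mul_right (continuous_const.matrix_mul hc)]
    refine congrArg (matInt μ) (funext fun g => ?_)
    rw [← rectConj_ketbra, rectConj_apply, hq]
  rw [h1]
  ext ⟨a, s, b⟩ ⟨a', s', b'⟩
  simp only [matInt, Matrix.of_apply, Matrix.submatrix_apply, Equiv.prodAssoc_symm_apply,
    Matrix.kroneckerMap_apply]
  rw [← integral_mul_const]
  refine integral_congr_ae (.of_forall fun g => ?_)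
  have hVV : ∑ c, star ((V g : Matrix β β ℂ) c b) * (V g : Matrix β β ℂ) c b' =
      (1 : Matrix β β ℂ) b b' := by
    rw [← Matrix.UnitaryGroup.star_mul_self (V g), Matrix.mul_apply]
    rfl
  simp only [measureDecoder, Matrix.mul_apply, Matrix.conjTranspose_apply, Matrix.of_apply, ketbra,
    Matrix.vecMulVec_apply, Pi.star_apply, star_mul', star_star]
  rw [← hVV, Finset.mul_sum]
  refine Finset.sum_congr rfl fun c _ => ?_
  ring

/-- Insert `r * q = 1` between `K` and `|U g⟩⟩`: the entries of `q |U g⟩⟩` and of `V g` then combine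
into conjugated entries of the decoder. -/
lemma bellAmp_eq_sum {q r : Matrix (α × α) (α × α) ℂ} (hrq : r * q = 1)
    (K : Matrix (β × β) (α × α) ℂ) (g : G) :
    bellAmp U V K g = ∑ x : (β × β) × (α × α), (K * r) x.1 x.2 *
      star (measureDecoder U V q g x.1.1 (x.2.1, x.2.2, x.1.2)) := by
  have h : K *ᵥ rowVec (U g : Matrix α α ℂ) = (K * r) *ᵥ (q *ᵥ rowVec (U g : Matrix α α ℂ)) := by
    rw [Matrix.mulVec_mulVec, Matrix.mul_assoc, hrq, Matrix.mul_one]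
  rw [bellAmp, h, Fintype.sum_prod_type]
  simp only [measureDecoder, Matrix.of_apply, star_mul', star_star]
  generalize q *ᵥ rowVec (U g : Matrix α α ℂ) = v
  refine Finset.sum_congr rfl fun p _ => ?_
  rw [Matrix.mulVec, dotProduct, Finset.mul_sum]
  refine Finset.sum_congr rfl fun y _ => ?_
  simp only [Pi.star_apply, rowVec]
  ring

lemma integral_bellAmp_sq_eq_sum (hU : Continuous U) (hV : Continuous V)
    {q r : Matrix (α × α) (α × α) ℂ} (hrq : r * q = 1) (K : Matrix (β × β) (α × α) ℂ) :
    ((∫ g, ‖bellAmp U V K g‖ ^ 2 ∂μ : ℝ) : ℂ) =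
      ∑ x : (β × β) × (α × α), (K * r) x.1 x.2 *
        (matInt μ fun g => star (bellAmp U V K g) • (measureDecoder U V q g)ᴴ)
          (x.2.1, x.2.2, x.1.2) x.1.1 := by
  have hint : ∀ x : (β × β) × (α × α), Continuous fun g => star (bellAmp U V K g) *
      star (measureDecoder U V q g x.1.1 (x.2.1, x.2.2, x.1.2)) := fun x =>
    (continuous_bellAmp hU hV K).star.mul
      ((continuous_measureDecoder hU hV q).matrix_elem _ _).star
  have hexp : ∀ g, ((‖bellAmp U V K g‖ ^ 2 : ℝ) : ℂ) =
      ∑ x : (β × β) × (α × α), (K * r) x.1 x.2 * (star (bellAmp U V K g) *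
        star (measureDecoder U V q g x.1.1 (x.2.1, x.2.2, x.1.2))) := by
    intro g
    have h : ((‖bellAmp U V K g‖ ^ 2 : ℝ) : ℂ) = star (bellAmp U V K g) * bellAmp U V K g := by
      rw [Complex.star_def, Complex.conj_mul']
      norm_cast
    rw [h]
    conv_lhs => enter [2]; rw [bellAmp_eq_sum hrq]
    rw [Finset.mul_sum]
    exact Finset.sum_congr rfl fun x _ => mul_left_comm _ _ _
  rw [← integral_complex_ofReal]
  simp only [hexp]
  rw [integral_finsetSum _ fun x _ => (integrable_of_continuous μ (hint x)).const_mul _]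
  exact Finset.sum_congr rfl fun x _ => integral_const_mul _ _

lemma sum_norm_sq_eq_frobSq (L : Matrix (α × (α × β)) β ℂ) :
    ∑ x : (β × β) × (α × α), ‖L (x.2.1, x.2.2, x.1.2) x.1.1‖ ^ 2 = frobSq L := by
  let e : (β × β) × (α × α) ≃ (α × (α × β)) × β :=
    ⟨fun x => ((x.2.1, x.2.2, x.1.2), x.1.1), fun z => ((z.2, z.1.2.2), (z.1.1, z.1.2.1)),
      fun _ => rfl, fun _ => rfl⟩
  rw [frobSq, ← Fintype.sum_prod_type (fun z : (α × (α × β)) × β => ‖L z.1 z.2‖ ^ 2)]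
  exact Equiv.sum_comp e fun z => ‖L z.1 z.2‖ ^ 2

/-- `‖K r‖² = Tr (K r² Kᴴ)`, and the Gram part of `r²` yields the average weight of `K |U g⟩⟩`. -/
lemma frobSq_mul_sqrt (hU : Continuous U) (K : Matrix (β × β) (α × α) ℂ) {ε : ℝ}
    {r : Matrix (α × α) (α × α) ℂ} (hr : rᴴ = r) (hrr : r * r = (ε : ℂ) • 1 + gram μ U) :
    frobSq (K * r) = ∫ g, bellWeight U K g ∂μ + ε * frobSq K := by
  have h := trace_mul_conjTranspose (K * r)
  rw [Matrix.conjTranspose_mul, hr, Matrix.mul_assoc, ← Matrix.mul_assoc r, hrr, Matrix.add_mul,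
    Matrix.mul_add, Matrix.trace_add, ← Matrix.mul_assoc K (gram μ U), trace_mul_gram_mul hU,
    Matrix.smul_mul, Matrix.one_mul, Matrix.mul_smul, Matrix.trace_smul,
    trace_mul_conjTranspose, smul_eq_mul] at h
  rw [add_comm]
  exact_mod_cast h.symm

/-- The missing effect is explicit: `1 - q (gram) q = ε q²`. -/
lemma posSemidef_one_sub_matInt_measureDecoder (hU : Continuous U) {ε : ℝ} (hε : 0 ≤ ε)
    {r q : Matrix (α × α) (α × α) ℂ} (hrr : r * r = (ε : ℂ) • 1 + gram μ U) (hrq : r * q = 1)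
    (hqr : q * r = 1) (hq : qᴴ = q) :
    (1 - matInt μ fun g => (measureDecoder U V q g)ᴴ * measureDecoder U V q g).PosSemidef := by
  have hqq : 1 - q * gram μ U * q = (ε : ℂ) • (qᴴ * q) := by
    have h : gram μ U = r * r - (ε : ℂ) • 1 := by rw [hrr, add_sub_cancel_left]
    rw [h, Matrix.mul_sub, Matrix.sub_mul, ← Matrix.mul_assoc, hqr, Matrix.one_mul, hrq, hq]
    simp
  have hpos : ((1 - q * gram μ U * q) ⊗ₖ (1 : Matrix β β ℂ)).PosSemidef := by
    rw [hqq]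
    exact ((Matrix.posSemidef_conjTranspose_mul_self q).smul (by exact_mod_cast hε)).kronecker
      Matrix.PosSemidef.one
  have hsub : (1 - q * gram μ U * q) ⊗ₖ (1 : Matrix β β ℂ) =
      1 - (q * gram μ U * q) ⊗ₖ (1 : Matrix β β ℂ) := by
    rw [← Matrix.one_kronecker_one (α := ℂ) (m := α × α) (n := β)]
    ext i j
    exact sub_mul _ _ _
  have h := hpos.submatrix (Equiv.prodAssoc α α β).symm
  rwa [hsub, Matrix.submatrix_sub, Pi.sub_apply,
    Pi.sub_apply, Matrix.submatrix_one_equiv, ← matInt_measureDecoder hU hq] at h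

variable [IsTopologicalGroup G] [μ.IsHaarMeasure]

lemma integral_bellAmp_sq_le (hbdd : BddAbove (gateDetFidelities μ U V)) (hU : Continuous U)
    (hV : Continuous V) (K : Matrix (β × β) (α × α) ℂ) {ε : ℝ} (hε : 0 < ε) :
    ∫ g, ‖bellAmp U V K g‖ ^ 2 ∂μ ≤ Fintype.card β * Real.sqrt (gateDet μ U V) *
      (∫ g, bellWeight U K g ∂μ + ε * frobSq K) := by
  have hwt : 0 ≤ ∫ g, bellWeight U K g ∂μ :=
    integral_nonneg fun g => Finset.sum_nonneg fun p _ => by positivity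
  have hK0 := frobSq_nonneg K
  rcases le_or_gt (∫ g, ‖bellAmp U V K g‖ ^ 2 ∂μ) 0 with hN0 | hN0
  · exact hN0.trans (by positivity)
  -- The Gram matrix may be singular; the shift by `ε` makes its square root invertible.
  have hεpos : ((ε : ℂ) • (1 : Matrix (α × α) (α × α) ℂ)).PosDef :=
    Matrix.PosDef.one.smul (by exact_mod_cast hε)
  obtain ⟨r, q, hrr, hrq, hqr, hr, hq, hcomm⟩ := PosDef.exists_sqrt
    (hεpos.add_posSemidef (posSemidef_gram (μ := μ) hU))
  have hqW : ∀ h, Commute q ((U h : Matrix α α ℂ) ⊗ₖ (1 : Matrix α α ℂ)) := fun h =>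
    hcomm _ (((Commute.one_left _).smul_left _).add_left (commute_gram hU h))
  have hNf : ∫ g, ‖star (bellAmp U V K g)‖ ^ 2 ∂μ = ∫ g, ‖bellAmp U V K g‖ ^ 2 ∂μ := by
    simp only [norm_star]
  have hgate := frobSq_matInt_div_sq_le_gateDet hbdd hU hV (continuous_measureDecoder hU hV q)
    (posSemidef_one_sub_matInt_measureDecoder hU hε.le hrr hrq hqr hq)
    (fun h g => measureDecoder_mul (hqW h) g) (continuous_bellAmp hU hV K).star (by rwa [hNf])
  have hpair := integral_bellAmp_sq_eq_sum (μ := μ) hU hV hrq K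
  rw [hNf] at hgate
  rw [← frobSq_mul_sqrt hU K hr hrr]
  generalize (matInt μ fun g => star (bellAmp U V K g) • (measureDecoder U V q g)ᴴ) = L
    at hgate hpair
  generalize (∫ g, ‖bellAmp U V K g‖ ^ 2 ∂μ) = N at *
  -- Choosing `f` as the conjugate amplitude makes `N` itself the pairing of `K * r` with `L`, to
  -- which Cauchy–Schwarz applies.
  have hcs : N ^ 2 ≤ frobSq (K * r) * frobSq L := by
    have h := norm_sum_mul_sq_le Finset.univ (fun x : (β × β) × (α × α) => (K * r) x.1 x.2)
      (fun x => L (x.2.1, x.2.2, x.1.2) x.1.1)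
    rw [← hpair, Complex.norm_real, Real.norm_eq_abs, sq_abs, sum_norm_sq_eq_frobSq,
      Fintype.sum_prod_type] at h
    exact h
  have hd : (0 : ℝ) < Fintype.card β := by positivity
  have hle : frobSq L / (N * Fintype.card β) ≤ Real.sqrt (gateDet μ U V) :=
    Real.le_sqrt_of_sq_le hgate
  rw [div_le_iff₀ (by positivity)] at hle
  have hKr0 := frobSq_nonneg (K * r)
  refine le_of_mul_le_mul_left ?_ hN0
  calc N * N = N ^ 2 := (sq N).symm
    _ ≤ frobSq (K * r) * frobSq L := hcs
    _ ≤ frobSq (K * r) * (Real.sqrt (gateDet μ U V) * (N * Fintype.card β)) := by gcongr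
    _ = _ := by ring

lemma integral_bellAmp_sq_le_sqrt_gateDet (hbdd : BddAbove (gateDetFidelities μ U V))
    (hU : Continuous U) (hV : Continuous V) (K : Matrix (β × β) (α × α) ℂ) :
    ∫ g, ‖bellAmp U V K g‖ ^ 2 ∂μ ≤ Fintype.card β * Real.sqrt (gateDet μ U V) *
      ∫ g, bellWeight U K g ∂μ := by
  have hlim : Filter.Tendsto (fun ε : ℝ => Fintype.card β * Real.sqrt (gateDet μ U V) *
      (∫ g, bellWeight U K g ∂μ + ε * frobSq K)) (nhdsWithin 0 (Set.Ioi 0))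
      (nhds (Fintype.card β * Real.sqrt (gateDet μ U V) *
        (∫ g, bellWeight U K g ∂μ + 0 * frobSq K))) :=
    (Continuous.tendsto (by fun_prop) 0).mono_left nhdsWithin_le_nhds
  rw [zero_mul, add_zero] at hlim
  exact ge_of_tendsto hlim (eventually_nhdsWithin_of_forall fun ε hε =>
    integral_bellAmp_sq_le hbdd hU hV K hε)

end Lower

/-! ### Summing over Kraus operators; nonemptiness and positivity. -/

section Bounds

variable {G : Type*} [Group G] [TopologicalSpace G] [CompactSpace G] [IsTopologicalGroup G]
  [MeasurableSpace G] [BorelSpace G]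
  {α β : Type*} [Fintype α] [DecidableEq α] [Fintype β] [DecidableEq β] [Nonempty α] [Nonempty β]
  {μ : Measure G} [IsProbabilityMeasure μ] [μ.IsHaarMeasure]
  {U : G →* Matrix.unitaryGroup α ℂ} {V : G →* Matrix.unitaryGroup β ℂ}

/-- Numerator and denominator of the fidelity are both sums over Kraus operators, so a termwise
bound with a common constant bounds the ratio. -/
lemma bellProbFidelities_le_sqrt_gateDet (hbdd : BddAbove (gateDetFidelities μ U V))
    (hU : Continuous U) (hV : Continuous V) :
    ∀ F ∈ bellProbFidelities μ U V, F ≤ Real.sqrt (gateDet μ U V) := by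
  rintro F ⟨M, hM, hpos, rfl⟩
  obtain ⟨m, K, rfl⟩ := hM.completelyPositive.exists_kraus
  rw [bellSuccess_kraus μ hU] at hpos
  have hpos' := pos_of_mul_pos_right hpos (by positivity)
  rw [bellFidelity_kraus μ hU hV, div_le_iff₀ (by positivity), ← mul_assoc,
    mul_comm (Real.sqrt _), Finset.mul_sum]
  exact Finset.sum_le_sum fun n _ => integral_bellAmp_sq_le_sqrt_gateDet hbdd hU hV (K n)

lemma bellProbFidelities_nonneg : ∀ F ∈ bellProbFidelities μ U V, 0 ≤ F := by
  rintro F ⟨M, hM, hpos, rfl⟩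
  refine div_nonneg (integral_nonneg fun g => ?_) hpos.le
  obtain ⟨m, K, rfl⟩ := hM.completelyPositive.exists_kraus
  simp only [overlap_bell_kraus]
  positivity

lemma exists_isChannel (α β : Type*) [Fintype α] [Fintype β] [Nonempty β] :
    ∃ Φ : Matrix α α ℂ →ₗ[ℂ] Matrix β β ℂ, IsChannel Φ := by
  classical
  obtain ⟨Φ, hΦ, htr⟩ := exists_isCompletelyPositive_trace (β := β)
    (Matrix.PosSemidef.one (n := α) (R := ℂ))
  exact ⟨Φ, hΦ, fun X => by rw [htr, Matrix.one_mul]⟩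

lemma gateDetFidelities_nonempty : (gateDetFidelities μ U V).Nonempty := by
  obtain ⟨A, hA⟩ := exists_isChannel β (α × Fin 1)
  obtain ⟨B, hB⟩ := exists_isChannel (α × Fin 1) β
  exact ⟨_, 1, A, B, hA, hB, rfl⟩

end Bounds

end BellConversion

theorem theorem7 {G : Type*} [Group G] [TopologicalSpace G] [IsTopologicalGroup G] [CompactSpace G]
    [MeasurableSpace G] [BorelSpace G]
    (μ : Measure G) [μ.IsHaarMeasure] [IsProbabilityMeasure μ]
    {α β : Type*} [Fintype α] [DecidableEq α] [Nonempty α] [Fintype β] [DecidableEq β] [Nonempty β]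
    (U : G →* Matrix.unitaryGroup α ℂ) (hU : Continuous U)
    (V : G →* Matrix.unitaryGroup β ℂ) (hV : Continuous V) :
    IsLUB (BellConversion.gateDetFidelities μ U V) (BellConversion.gateDet μ U V) ∧
    IsLUB (BellConversion.bellProbFidelities μ U V) (BellConversion.bellProb μ U V) ∧
    BellConversion.bellProb μ U V ^ 2 ≤ BellConversion.gateDet μ U V ∧
    BellConversion.gateDet μ U V ≤ BellConversion.bellProb μ U V := by
  open BellConversion in
  have hsub := gateDetFidelities_subset μ hU hV
  have hbdd' : BddAbove (bellProbFidelities μ U V) := ⟨1, bellProbFidelities_le_one μ hU hV⟩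
  -- Boundedness of the gate fidelities comes from the teleportation inclusion, and the lower bound
  -- needs it to compare its networks with the supremum.
  have hbdd : BddAbove (gateDetFidelities μ U V) := hbdd'.mono hsub
  have hne : (gateDetFidelities μ U V).Nonempty := gateDetFidelities_nonempty
  have hne' := hne.mono hsub
  have hgate0 : 0 ≤ gateDet μ U V :=
    Real.sSup_nonneg fun F hF => bellProbFidelities_nonneg F (hsub hF)
  refine ⟨isLUB_csSup hne hbdd, isLUB_csSup hne' hbdd', ?_, csSup_le_csSup hbdd' hne hsub⟩
  refine (Real.le_sqrt (Real.sSup_nonneg bellProbFidelities_nonneg) hgate0).mp ?_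
  exact csSup_le hne' (bellProbFidelities_le_sqrt_gateDet hbdd hU hV)
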